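/- Let $N\ge 2$ be an integer and $a,b>0$, and consider the $2\pi$-periodic planar vector field $$X(x,y,t)=\bigl(-ax^{N},\; b\,x^{N-1}y+x^{N+1}\cos t\bigr).$$ Put $\gamma=\frac1{N-1}$, $\sigma=\frac{N+1}{N-1}+\frac{b}{a(N-1)}$ and, for $x\ge 0$, $t\in\mathbb R$, $$\varphi(x,t)=-x^{N+1}\int_0^\infty \frac{\cos(t+\tau)}{\bigl(1+a(N-1)\tau x^{N-1}\bigr)^{\sigma}}\,d\tau ,\qquad \varphi(0,t)=0 .$$ A formal series $\sum c_n x^n$ is called $s$-Gevrey if there are $c_1,c_2>0$ with $\|c_n\|\le c_1c_2^n\,n!^{\,s}$ for all $n\ge 0$. Then: 1. For $x>0$ the integral converges absolutely; $\varphi$ is $2\pi$-periodic in $t$; and for every $t_0$ the parabolic stable manifold of the origin at time $t_0$, i.e. the set of points $(x_0,y_0)$ with $x_0>0$ whose solution with initial time $t_0$ exists for all $t\ge t_0$ and tends to $(0,0)$ as $t\to\infty$, is the graph $\{y_0=\varphi(x_0,t_0),\ x_0>0\}$. 2. For every $t$ the function $\varphi(\cdot,t)$ is $C^\infty$ on $[0,\infty)$,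 and its Taylor series $\hat\varphi(x,t)=\sum_n\varphi_n(t)x^n$ at $x=0$ is Gevrey of order exactly $\gamma$: there are $c_1,c_2>0$ with $|\varphi_n(t)|\le c_1c_2^n\,n!^{\,\gamma}$ for all $n$ and $t$, and for no $t$ and no $0\le\gamma'<\gamma$ is the series $\sum_n\varphi_n(t)x^n$ $\gamma'$-Gevrey. 3. (Sharpness for maps with $M=N$, $d'=0$.) For every $t_0$ the stroboscopic Poincaré map $P$ of $X$ from time $t_0$ to time $t_0+2\pi$ is defined near the origin and is there of the form $$P(x,y)=\bigl(x-2\pi a\,x^{N}+f_N+f_{\ge N+1},\; y+2\pi b\,x^{N-1}y+g_N+g_{\ge N+1}\bigr),$$ where $f_N,g_N$ are homogeneous polynomials of degree $N$ with $f_N(x,0)=g_N(x,0)=\partial_yg_N(x,0)=0$, and $f_{\ge N+1},g_{\ge N+1}$ are real analytic at the origin of order $N+1$. For all small $\rho>0$ its local stable manifold $\{p: P^k(p)\in B(\rho)\cap\{x>0\}\ \forall k\ge0\}$ is $\{(x,y)\in B(\rho): x>0,\ y=\varphi(x,t_0)\}$. The formal parameterization $\hat K(s)=(s,\hat\varphi(s,t_0))$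 is $\gamma$-Gevrey and solves $P\circ\hat K=\hat K\circ\hat R$ for some formal series $\hat R$ with $\hat R(0)=0$; and no pair of formal series $(\hat K,\hat R)$ with $\hat K_0=(0,0)$, $\hat K_1=(1,0)$, $\hat R_0=0$ and $P\circ\hat K=\hat K\circ\hat R$ has $\hat K$ $\gamma'$-Gevrey for some $0\le\gamma'<\gamma$. -/

import Mathlib

open Filter Topology Set MeasureTheory

namespace ParabolicGevrey

/-- The time-periodic vector field `X(x, y, t) = (-a x^N, b x^(N-1) y + x^(N+1) cos t)`. -/
noncomputable def field (N : ℕ) (a b : ℝ) (p : ℝ × ℝ) (t : ℝ) : ℝ × ℝ :=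
  (-a * p.1 ^ N, b * p.1 ^ (N - 1) * p.2 + p.1 ^ (N + 1) * Real.cos t)

/-- `ξ` solves the differential equation `ξ' = X(ξ, t)` on the time set `s`
(one-sided derivatives at end points). -/
def IsSolutionOn (X : ℝ × ℝ → ℝ → ℝ × ℝ) (ξ : ℝ → ℝ × ℝ) (s : Set ℝ) : Prop :=
  ∀ t ∈ s, HasDerivWithinAt ξ (X (ξ t) t) s t

/-- The solution starting at `p` at time `t₀` exists up to time `t₀ + T`. -/
def SolvableFrom (X : ℝ × ℝ → ℝ → ℝ × ℝ) (t₀ T : ℝ) (p : ℝ × ℝ) : Prop :=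
  ∃ ξ : ℝ → ℝ × ℝ, IsSolutionOn X ξ (Icc t₀ (t₀ + T)) ∧ ξ t₀ = p

open Classical in
/-- The stroboscopic Poincaré map: a point `p` is sent to the value at time `t₀ + T` of the solution
that starts at `p` at time `t₀` (and to `0` if there is no such solution). -/
noncomputable def stroboscopicMap (X : ℝ × ℝ → ℝ → ℝ × ℝ) (t₀ T : ℝ) (p : ℝ × ℝ) : ℝ × ℝ :=
  if h : SolvableFrom X t₀ T p then h.choose (t₀ + T) else 0

/-- The stable set, in the half plane `x > 0` and at initial time `t₀`, of the origin:
the initial points whose solution exists for all later times and tends to the origin. -/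
def stableSet (X : ℝ × ℝ → ℝ → ℝ × ℝ) (t₀ : ℝ) : Set (ℝ × ℝ) :=
  {p | 0 < p.1 ∧ ∃ ξ : ℝ → ℝ × ℝ, IsSolutionOn X ξ (Ici t₀) ∧ ξ t₀ = p ∧
    Tendsto ξ atTop (𝓝 0)}

/-- The open Euclidean disc of radius `ρ` about the origin of the plane. -/
def disc (ρ : ℝ) : Set (ℝ × ℝ) := {p | p.1 ^ 2 + p.2 ^ 2 < ρ ^ 2}

/-- The local stable manifold `W^s_ρ` of a planar map `F`: the points of the disc of radius `ρ` all
of whose iterates lie in that disc and in `{x > 0}`. -/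
def localStableManifold (F : ℝ × ℝ → ℝ × ℝ) (ρ : ℝ) : Set (ℝ × ℝ) :=
  {p | ∀ k : ℕ, F^[k] p ∈ disc ρ ∧ 0 < (F^[k] p).1}

/-- The exponent `σ = (N + 1)/(N - 1) + b/(a (N - 1))`. -/
noncomputable def sigma (N : ℕ) (a b : ℝ) : ℝ :=
  ((N : ℝ) + 1) / ((N : ℝ) - 1) + b / (a * ((N : ℝ) - 1))

/-- The integrand `τ ↦ cos (t + τ) / (1 + a (N - 1) τ x^(N-1))^σ`. -/
noncomputable def integrand (N : ℕ) (a b x t τ : ℝ) : ℝ :=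
  Real.cos (t + τ) / (1 + a * ((N : ℝ) - 1) * τ * x ^ (N - 1)) ^ sigma N a b

/-- `φ(x, t) = - x^(N+1) ∫_0^∞ cos (t + τ) / (1 + a (N - 1) τ x^(N-1))^σ dτ`.
At `x = 0` the prefactor makes it `0`. -/
noncomputable def phi (N : ℕ) (a b x t : ℝ) : ℝ :=
  -x ^ (N + 1) * ∫ τ in Ioi (0 : ℝ), integrand N a b x t τ

/-- The `n`-th coefficient of the one-sided Taylor expansion at `0` of a function on `[0, ∞)`. -/
noncomputable def taylorCoeff (f : ℝ → ℝ) (n : ℕ) : ℝ :=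
  iteratedDerivWithin n f (Ici 0) 0 / (n.factorial : ℝ)

/-- The formal series `∑ cₙ tⁿ` is `s`-Gevrey: `‖cₙ‖ ≤ c₁ c₂ⁿ (n!)^s` for all `n`. -/
def IsGevrey {E : Type*} [Norm E] (s : ℝ) (c : ℕ → E) : Prop :=
  ∃ c₁ c₂ : ℝ, 0 < c₁ ∧ 0 < c₂ ∧ ∀ n : ℕ, ‖c n‖ ≤ c₁ * c₂ ^ n * (n.factorial : ℝ) ^ s

/-- A planar map of the form
`F(x, y) = (x - a x^N + f_N + f_{≥N+1}, y + x^(M-1) B y + g_M + g_{≥M+1})` near the origin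
(one variable `y`, no variable `z`): `f_N`, `g_M` are homogeneous polynomials of degrees `N`, `M`
with `f_N(x, 0) = 0`, `g_M(x, 0) = 0`, `∂_y g_M(x, 0) = 0`, and `f_{≥N+1}`, `g_{≥M+1}` are real
analytic at the origin of orders `N + 1`, `M + 1`. -/
def HasParabolicForm (N M : ℕ) (a B : ℝ) (F : ℝ × ℝ → ℝ × ℝ) : Prop :=
  ∃ (fN gM : MvPolynomial (Fin 2) ℝ) (f g : ℝ × ℝ → ℝ),
    fN.IsHomogeneous N ∧ gM.IsHomogeneous M ∧
    (∀ x : ℝ, MvPolynomial.eval ![x, 0] fN = 0) ∧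
    (∀ x : ℝ, MvPolynomial.eval ![x, 0] gM = 0) ∧
    (∀ x : ℝ, MvPolynomial.eval ![x, 0] (MvPolynomial.pderiv 1 gM) = 0) ∧
    AnalyticAt ℝ f 0 ∧ AnalyticAt ℝ g 0 ∧
    f =O[𝓝 0] (fun p => ‖p‖ ^ (N + 1)) ∧ g =O[𝓝 0] (fun p => ‖p‖ ^ (M + 1)) ∧
    ∀ᶠ p in 𝓝 (0 : ℝ × ℝ), F p =
      (p.1 - a * p.1 ^ N + MvPolynomial.eval ![p.1, p.2] fN + f p,
        p.2 + p.1 ^ (M - 1) * B * p.2 + MvPolynomial.eval ![p.1, p.2] gM + g p)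

/-- The truncation `∑_{k ≤ n} c_k t^k` of a formal series. -/
def truncation {E : Type*} [AddCommGroup E] [Module ℝ E] (c : ℕ → E) (n : ℕ) (t : ℝ) : E :=
  ∑ k ∈ Finset.range (n + 1), t ^ k • c k

/-- The formal series `K = ∑ K_n t^n`, `R = ∑ R_n t^n`, with `K_0 = 0`, `K_1 = (1, 0)`, `R_0 = 0`,
solve the invariance equation `F ∘ K = K ∘ R` in the sense of formal composition. For a map `F`
that is analytic at the origin, two such compositions agree up to order `n` iff the
compositions of the truncations to order `n` differ by `O(t^(n+1))`. -/
def IsFormalSolution (F : ℝ × ℝ → ℝ × ℝ) (K : ℕ → ℝ × ℝ) (R : ℕ → ℝ) : Prop :=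
  K 0 = 0 ∧ K 1 = (1, 0) ∧ R 0 = 0 ∧
  ∀ n : ℕ, (fun t : ℝ => F (truncation K n t) - truncation K n (truncation R n t))
    =O[𝓝 0] (fun t : ℝ => t ^ (n + 1))

/-- The formal parameterization `t ↦ (t, ∑ c_n t^n)` of a formal graph `y = ∑ c_n x^n`. -/
def graphSeries (c : ℕ → ℝ) (n : ℕ) : ℝ × ℝ := (if n = 1 then 1 else 0, c n)

end ParabolicGevrey

open ParabolicGevrey

/-! The system is triangular and integrates explicitly. Put `c = a(N-1)`, `β = b/c` and `D(τ) = 1 +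
c τ x^(N-1)`. The first component is `x D^(-1/(N-1))`, and variation of constants gives the second
as `D^β (y + x^(N+1) ∫_0^τ cos(t+s) D(s)^(-σ) ds)`. Since `D^β → ∞`, a solution with `x > 0` can
tend to the origin only if the bracket tends to zero, that is, if `y = φ(x, t)` (`stableSet_field`).

With `z = x^(N-1)`, rotating the contour suggests that the improper integral is the real part of `i
e^(it) ∫_0^∞ e^(-s) (1 + i c s z)^(-σ) ds`. No contour is moved: a linear differential equation in
`z` for this Laplace integral yields a primitive of the oscillatory integrand
(`hasDerivAt_tailIntegral`). The Laplace form is smooth for all real `z`, and its `j`-th Taylor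
coefficient at zero is `(-ic)^j σ(σ+1)⋯(σ+j-1)`. So the series of `φ` lives on the exponents `n =
N+1+(N-1)j`, where its coefficient has size `j!` up to geometric factors, times `|sin t|` or `|cos
t|` according to the parity of `j`. These do not both vanish, and `j!` compares with `n!^(1/(N-1))`,
so the Gevrey order is exact (`not_isGevrey_taylorCoeff_phi`).

Over one period the integral is analytic near `z = 0`, which gives the normal form of the Poincaré
map `P`. In the coordinate `y - φ`, `P` is linear on fibres with factor `D^β`; this gives both the
local stable manifold and the formal invariance of the graph. For an arbitrary formal solution `K =
(p, q)`, the defect `q - φ̂ ∘ p` satisfies `U · defect = defect ∘ R` with `U = 1 + 2πb t^(N-1) + ⋯`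
and `R = t - 2πa t^N + ⋯`. A leading term of degree `k` would be multiplied by `2π(b + ak) > 0` at
the next relevant order, so the defect is zero (`X_pow_dvd_of_semiconj`). Thus `q = φ̂ ∘ p`, and by
Lagrange inversion `φ̂` would inherit any Gevrey order of `K` (`isGevrey_of_comp`). -/

namespace ParabolicGevrey

/-! ### Laplace integrals: smoothness, derivatives at zero, differential equation -/

/-- The Laplace-type integral `∫_0^∞ e^{-s} s^k (1 + i c s z)^{-r} ds`. -/
noncomputable def laplaceInt (c r : ℝ) (k : ℕ) (z : ℝ) : ℂ :=
  ∫ s in Ioi (0 : ℝ), ((Real.exp (-s) * s ^ k : ℝ) : ℂ) *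
    (1 + Complex.I * c * s * z) ^ ((-r : ℝ) : ℂ)

theorem hasDerivAt_cpow_const_of_real {f : ℝ → ℂ} {f' : ℂ} {x : ℝ} (hf : HasDerivAt f f' x)
    (hx : f x ∈ Complex.slitPlane) (r : ℂ) :
    HasDerivAt (fun y => f y ^ r) (r * f x ^ (r - 1) * f') x := by
  have h := ((hasDerivAt_id (f x)).cpow_const (c := r) hx).comp x hf
  simpa [Function.comp_def] using h

theorem one_le_norm_one_add_I_mul (c s z : ℝ) : 1 ≤ ‖(1 + Complex.I * c * s * z : ℂ)‖ := by
  have h := Complex.abs_re_le_norm (1 + Complex.I * c * s * z : ℂ)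
  simpa using h

theorem one_add_I_mul_mem_slitPlane (c s z : ℝ) :
    (1 + Complex.I * c * s * z : ℂ) ∈ Complex.slitPlane := by
  left; simp

/-- The base has real part `1`, so its modulus is at least `1` whatever the sign of `z`. All later
dominations are therefore uniform over the whole real line. -/
theorem norm_one_add_I_mul_cpow_le {r : ℝ} (hr : 0 ≤ r) (c s z : ℝ) :
    ‖(1 + Complex.I * c * s * z : ℂ) ^ ((-r : ℝ) : ℂ)‖ ≤ 1 := by
  rw [Complex.norm_cpow_real]
  exact Real.rpow_le_one_of_one_le_of_nonpos (one_le_norm_one_add_I_mul c s z) (by linarith)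

theorem integrableOn_exp_neg_mul_pow (k : ℕ) :
    IntegrableOn (fun s : ℝ => Real.exp (-s) * s ^ k) (Ioi 0) := by
  have h := Real.GammaIntegral_convergent (s := (k : ℝ) + 1) (by positivity)
  refine h.congr_fun (fun s _ => ?_) measurableSet_Ioi
  simp

theorem integral_exp_neg_mul_pow (k : ℕ) :
    ∫ s in Ioi (0 : ℝ), Real.exp (-s) * s ^ k = (k.factorial : ℝ) := by
  rw [← Real.Gamma_nat_eq_factorial, Real.Gamma_eq_integral (by positivity)]
  refine setIntegral_congr_fun measurableSet_Ioi (fun s _ => ?_)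
  simp

theorem continuous_laplaceInt_integrand (c r : ℝ) (k : ℕ) (z : ℝ) :
    Continuous (fun s : ℝ => ((Real.exp (-s) * s ^ k : ℝ) : ℂ) *
      (1 + Complex.I * c * s * z) ^ ((-r : ℝ) : ℂ)) := by
  refine Continuous.mul (by fun_prop) ?_
  exact Continuous.cpow (by fun_prop) continuous_const (fun s => one_add_I_mul_mem_slitPlane c s z)

theorem norm_laplaceInt_integrand_le {r : ℝ} (hr : 0 ≤ r) (c : ℝ) (k : ℕ) (z : ℝ) {s : ℝ}
    (hs : 0 < s) : ‖((Real.exp (-s) * s ^ k : ℝ) : ℂ) *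
      (1 + Complex.I * c * s * z) ^ ((-r : ℝ) : ℂ)‖ ≤ Real.exp (-s) * s ^ k := by
  rw [norm_mul, Complex.norm_real, Real.norm_of_nonneg (by positivity)]
  exact mul_le_of_le_one_right (by positivity) (norm_one_add_I_mul_cpow_le hr c s z)

theorem integrableOn_laplaceInt_integrand {r : ℝ} (hr : 0 ≤ r) (c : ℝ) (k : ℕ) (z : ℝ) :
    IntegrableOn (fun s : ℝ => ((Real.exp (-s) * s ^ k : ℝ) : ℂ) *
      (1 + Complex.I * c * s * z) ^ ((-r : ℝ) : ℂ)) (Ioi 0) := by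
  refine (integrableOn_exp_neg_mul_pow k).mono'
    (continuous_laplaceInt_integrand c r k z).aestronglyMeasurable ?_
  refine (ae_restrict_iff' measurableSet_Ioi).2 (Eventually.of_forall fun s hs => ?_)
  exact norm_laplaceInt_integrand_le hr c k z hs

theorem norm_laplaceInt_le {r : ℝ} (hr : 0 ≤ r) (c : ℝ) (k : ℕ) (z : ℝ) :
    ‖laplaceInt c r k z‖ ≤ k.factorial := by
  rw [← integral_exp_neg_mul_pow]
  refine norm_integral_le_of_norm_le (integrableOn_exp_neg_mul_pow k) ?_
  refine (ae_restrict_iff' measurableSet_Ioi).2 (Eventually.of_forall fun s hs => ?_)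
  exact norm_laplaceInt_integrand_le hr c k z hs

theorem laplaceInt_zero (c r : ℝ) (k : ℕ) : laplaceInt c r k 0 = k.factorial := by
  have h : laplaceInt c r k 0 = ∫ s in Ioi (0 : ℝ), ((Real.exp (-s) * s ^ k : ℝ) : ℂ) := by
    simp [laplaceInt]
  rw [h, integral_complex_ofReal, integral_exp_neg_mul_pow]
  simp

/-- Differentiating the kernel in `z` brings down one factor `s` and raises `r` by one, so the
family is closed under derivatives. The dominating function does not depend on `z`. -/
theorem hasDerivAt_laplaceInt {r : ℝ} (hr : 0 ≤ r) (c : ℝ) (k : ℕ) (z : ℝ) :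
    HasDerivAt (laplaceInt c r k)
      (-(r * Complex.I * c) * laplaceInt c (r + 1) (k + 1) z) z := by
  have key := hasDerivAt_integral_of_dominated_loc_of_deriv_le (𝕜 := ℝ)
    (μ := volume.restrict (Ioi (0 : ℝ))) (s := univ) (x₀ := z)
    (F := fun z s => ((Real.exp (-s) * s ^ k : ℝ) : ℂ) *
      (1 + Complex.I * c * s * z) ^ ((-r : ℝ) : ℂ))
    (F' := fun z s => -(r * Complex.I * c) * (((Real.exp (-s) * s ^ (k + 1) : ℝ) : ℂ) *
      (1 + Complex.I * c * s * z) ^ ((-(r + 1) : ℝ) : ℂ)))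
    (bound := fun s => (r * |c|) * (Real.exp (-s) * s ^ (k + 1)))
    univ_mem
    (Eventually.of_forall fun z => (continuous_laplaceInt_integrand c r k z).aestronglyMeasurable)
    (integrableOn_laplaceInt_integrand hr c k z)
    ((continuous_laplaceInt_integrand c (r + 1) (k + 1) z).const_mul _).aestronglyMeasurable
    ?_ ((integrableOn_exp_neg_mul_pow (k + 1)).const_mul _) ?_
  · have := key.2
    rwa [integral_const_mul] at this
  · refine (ae_restrict_iff' measurableSet_Ioi).2 (Eventually.of_forall fun s hs x _ => ?_)
    rw [norm_mul]
    have h1 : ‖-(r * Complex.I * c : ℂ)‖ = r * |c| := by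
      simp [abs_of_nonneg hr]
    rw [h1]
    exact mul_le_mul_of_nonneg_left (norm_laplaceInt_integrand_le (by linarith) c _ x hs)
      (by positivity)
  · refine Eventually.of_forall fun s x _ => ?_
    have h1 : HasDerivAt (fun x : ℝ => (1 + Complex.I * c * s * x : ℂ)) (Complex.I * c * s) x := by
      simpa using ((Complex.ofRealCLM.hasDerivAt (x := x)).const_mul (Complex.I * c * s)).const_add 1
    have h2 := (hasDerivAt_cpow_const_of_real h1 (one_add_I_mul_mem_slitPlane c s x)
      ((-r : ℝ) : ℂ)).const_mul ((Real.exp (-s) * s ^ k : ℝ) : ℂ)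
    convert! h2 using 1
    have : ((-(r + 1) : ℝ) : ℂ) = ((-r : ℝ) : ℂ) - 1 := by push_cast; ring
    rw [this]
    push_cast
    ring

theorem contDiff_laplaceInt (c : ℝ) (n : ℕ) :
    ∀ {r : ℝ}, 0 ≤ r → ∀ k : ℕ, ContDiff ℝ n (laplaceInt c r k) := by
  induction n with
  | zero =>
    intro r hr k
    exact contDiff_zero.2
      (continuous_iff_continuousAt.2 fun z => (hasDerivAt_laplaceInt hr c k z).continuousAt)
  | succ n ih =>
    intro r hr k
    rw [Nat.cast_add, Nat.cast_one, contDiff_succ_iff_deriv]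
    refine ⟨fun z => (hasDerivAt_laplaceInt hr c k z).differentiableAt, by simp, ?_⟩
    have : deriv (laplaceInt c r k) =
        fun z => -(r * Complex.I * c) * laplaceInt c (r + 1) (k + 1) z :=
      funext fun z => (hasDerivAt_laplaceInt hr c k z).deriv
    rw [this]
    exact contDiff_const.mul (ih (by linarith) (k + 1))

theorem contDiff_infty_laplaceInt (c : ℝ) {r : ℝ} (hr : 0 ≤ r) (k : ℕ) :
    ContDiff ℝ (⊤ : ℕ∞) (laplaceInt c r k) :=
  contDiff_infty.2 fun n => contDiff_laplaceInt c n hr k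

theorem iteratedDeriv_laplaceInt (c : ℝ) (n : ℕ) :
    ∀ {r : ℝ}, 0 ≤ r → ∀ k : ℕ, ∀ z : ℝ, iteratedDeriv n (laplaceInt c r k) z =
      (∏ j ∈ Finset.range n, -((r + j) * Complex.I * c)) * laplaceInt c (r + n) (k + n) z := by
  induction n with
  | zero => intro r hr k z; simp
  | succ n ih =>
    intro r hr k z
    have : iteratedDeriv n (laplaceInt c r k) = fun z =>
      (∏ j ∈ Finset.range n, -((r + j) * Complex.I * c)) * laplaceInt c (r + n) (k + n) z :=
      funext (ih hr k)
    rw [iteratedDeriv_succ, this, ((hasDerivAt_laplaceInt (by positivity) c (k + n) z).const_mul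
      _).deriv, Finset.prod_range_succ]
    push_cast
    rw [add_assoc, add_assoc]
    ring

/-- Integrates the derivative of `e^(-s) (1 + i c s z)^(-r)` over the half line; the boundary value
at `s = 0` is `1`. -/
theorem laplaceInt_integral_by_parts {r : ℝ} (hr : 0 ≤ r) (c z : ℝ) :
    laplaceInt c r 0 z = 1 - r * (Complex.I * c * z) * laplaceInt c (r + 1) 0 z := by
  have key := integral_Ioi_of_hasDerivAt_of_tendsto' (a := (0 : ℝ)) (m := 0)
    (f := fun s : ℝ => ((Real.exp (-s) * s ^ 0 : ℝ) : ℂ) *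
      (1 + Complex.I * c * s * z) ^ ((-r : ℝ) : ℂ))
    (f' := fun s : ℝ => -(((Real.exp (-s) * s ^ 0 : ℝ) : ℂ) *
      (1 + Complex.I * c * s * z) ^ ((-r : ℝ) : ℂ)) - r * (Complex.I * c * z) *
      (((Real.exp (-s) * s ^ 0 : ℝ) : ℂ) * (1 + Complex.I * c * s * z) ^ ((-(r + 1) : ℝ) : ℂ)))
    ?_ ?_ ?_
  · rw [integral_sub, integral_neg, integral_const_mul] at key
    · change -laplaceInt c r 0 z - _ * laplaceInt c (r + 1) 0 z = _ at key
      simp at key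
      linear_combination -key
    · exact (integrableOn_laplaceInt_integrand hr c 0 z).neg
    · exact (integrableOn_laplaceInt_integrand (by linarith) c 0 z).const_mul _
  · intro s _
    have h1 : HasDerivAt (fun s : ℝ => (1 + Complex.I * c * s * z : ℂ)) (Complex.I * c * z) s := by
      simpa using (((Complex.ofRealCLM.hasDerivAt (x := s)).const_mul
        (Complex.I * c)).mul_const (z : ℂ)).const_add 1
    have h2 := hasDerivAt_cpow_const_of_real h1 (one_add_I_mul_mem_slitPlane c s z) ((-r : ℝ) : ℂ)
    have h3 : HasDerivAt (fun s : ℝ => ((Real.exp (-s) * s ^ 0 : ℝ) : ℂ))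
        ((-Real.exp (-s) : ℝ) : ℂ) s := by
      simpa using ((Real.hasDerivAt_exp (-s)).comp s (hasDerivAt_neg s)).ofReal_comp
    convert! h3.mul h2 using 1
    have : ((-(r + 1) : ℝ) : ℂ) = ((-r : ℝ) : ℂ) - 1 := by push_cast; ring
    rw [this]
    push_cast
    ring
  · exact (integrableOn_laplaceInt_integrand hr c 0 z).neg.sub
      ((integrableOn_laplaceInt_integrand (by linarith) c 0 z).const_mul _)
  · rw [tendsto_zero_iff_norm_tendsto_zero]
    refine squeeze_zero' (Eventually.of_forall fun s => norm_nonneg _) (g := fun s => Real.exp (-s))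
      ?_ (Real.tendsto_exp_neg_atTop_nhds_zero)
    filter_upwards [eventually_gt_atTop 0] with s hs
    simpa using norm_laplaceInt_integrand_le hr c 0 z hs

/-- One factor `1 + i c s z` is split off the kernel of exponent `r + 1`. -/
theorem laplaceInt_eq_add {r : ℝ} (hr : 0 ≤ r) (c z : ℝ) :
    laplaceInt c r 0 z =
      laplaceInt c (r + 1) 0 z + Complex.I * c * z * laplaceInt c (r + 1) 1 z := by
  unfold laplaceInt
  rw [← integral_const_mul, ← integral_add (integrableOn_laplaceInt_integrand (by linarith) c 0 z)
    ((integrableOn_laplaceInt_integrand (by linarith) c 1 z).const_mul _)]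
  refine setIntegral_congr_fun measurableSet_Ioi (fun s _ => ?_)
  have hw := one_add_I_mul_mem_slitPlane c s z
  have : ((-r : ℝ) : ℂ) = ((-(r + 1) : ℝ) : ℂ) + 1 := by push_cast; ring
  rw [this, Complex.cpow_add _ _ (Complex.slitPlane_ne_zero hw), Complex.cpow_one]
  push_cast
  ring

/-- The linear differential equation `i c z² G' = 1 - (1 + i r c z) G`. -/
theorem hasDerivAt_laplaceInt_zero {r : ℝ} (hr : 0 ≤ r) (c z : ℝ) :
    ∃ G' : ℂ, HasDerivAt (laplaceInt c r 0) G' z ∧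
      Complex.I * c * z ^ 2 * G' = 1 - (1 + Complex.I * r * c * z) * laplaceInt c r 0 z := by
  refine ⟨_, hasDerivAt_laplaceInt hr c 0 z, ?_⟩
  have h1 := laplaceInt_integral_by_parts hr c z
  have h2 := laplaceInt_eq_add hr c z
  rw [zero_add]
  -- The two relations share the integral with parameters `r + 1`, `0`; eliminating it leaves the
  -- function and its derivative.
  linear_combination (Complex.I * r * c * z) * h2 + h1

/-! ### A primitive of the oscillatory integrand -/

/-- The primitive of `-e^{i(t + τ)} (1 + c τ z)^{-r}` that vanishes as `τ → ∞` if `z > 0`. -/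
noncomputable def tailIntegral (c r z t τ : ℝ) : ℂ :=
  Complex.I * Complex.exp (Complex.I * (t + τ)) * ((1 + c * τ * z) ^ (-r) : ℝ) *
    laplaceInt c r 0 (z / (1 + c * τ * z))

/-- Let `w = z / (1 + c τ z)`. Then `w' = -c w²`, and the logarithmic derivative of `(1 + c τ
z)^(-r)` is `-r c w`. The product rule thus produces exactly the left side of the differential
equation of the Laplace integral at `w`. -/
theorem hasDerivAt_tailIntegral {r : ℝ} (hr : 0 ≤ r) (c z t τ : ℝ) (hu : 0 < 1 + c * τ * z) :
    HasDerivAt (tailIntegral c r z t)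
      (-(Complex.exp (Complex.I * (t + τ)) * ((1 + c * τ * z) ^ (-r) : ℝ))) τ := by
  have hu1 : HasDerivAt (fun τ : ℝ => 1 + c * τ * z) (c * z) τ := by
    simpa using (((hasDerivAt_id τ).const_mul c).mul_const z).const_add 1
  have hw : HasDerivAt (fun τ : ℝ => z / (1 + c * τ * z))
      (-(c * z ^ 2) / (1 + c * τ * z) ^ 2) τ := by
    convert! (hasDerivAt_const τ z).div hu1 hu.ne' using 1
    ring
  obtain ⟨G', hG, hode⟩ := hasDerivAt_laplaceInt_zero hr c (z / (1 + c * τ * z))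
  have hG1 := hG.scomp τ hw
  have hp := (hu1.rpow_const (p := -r) (Or.inl hu.ne')).ofReal_comp
  have he : HasDerivAt (fun τ : ℝ => Complex.I * Complex.exp (Complex.I * (t + τ)))
      (Complex.I * (Complex.exp (Complex.I * (t + τ)) * Complex.I)) τ := by
    have : HasDerivAt (fun τ : ℝ => Complex.I * ((t : ℂ) + τ)) Complex.I τ := by
      simpa using ((Complex.ofRealCLM.hasDerivAt (x := τ)).const_add (t : ℂ)).const_mul Complex.I
    exact this.cexp.const_mul _
  convert! (he.mul hp).mul hG1 using 1
  have hpow : (1 + c * τ * z) ^ (-r - 1) = (1 + c * τ * z) ^ (-r) / (1 + c * τ * z) := by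
    rw [Real.rpow_sub_one hu.ne']
  rw [hpow]
  have hu' : (1 + c * τ * z : ℂ) ≠ 0 := by exact_mod_cast hu.ne'
  simp only [Complex.real_smul, Function.comp, Pi.mul_apply]
  push_cast at hode ⊢
  -- Once the transcendental quantities are free variables, the identity is a multiple of the
  -- differential equation, up to `i² = -1`.
  generalize laplaceInt c r 0 (z / (1 + c * τ * z)) = G at hode ⊢
  generalize (((1 + c * τ * z) ^ (-r) : ℝ) : ℂ) = U at hode ⊢
  generalize Complex.exp (Complex.I * (t + τ)) = E at hode ⊢
  generalize (1 + c * τ * z : ℂ) = u at hode hu' ⊢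
  have h1 : Complex.I * c * z ^ 2 * G' / u ^ 2 = 1 - (1 + Complex.I * r * c * z / u) * G := by
    linear_combination hode
  linear_combination (E * U) * h1 - E * U * G * Complex.I_sq

theorem norm_tailIntegral_le {r : ℝ} (hr : 0 ≤ r) (c z t : ℝ) {τ : ℝ} (hu : 0 < 1 + c * τ * z) :
    ‖tailIntegral c r z t τ‖ ≤ (1 + c * τ * z) ^ (-r) := by
  unfold tailIntegral
  have h1 : ‖Complex.exp (Complex.I * (t + τ))‖ = 1 := by
    rw [Complex.norm_exp]; simp
  rw [norm_mul, norm_mul, norm_mul, Complex.norm_I, h1, Complex.norm_real,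
    Real.norm_of_nonneg (Real.rpow_nonneg hu.le _)]
  have := norm_laplaceInt_le hr c 0 (z / (1 + c * τ * z))
  simp only [Nat.factorial_zero, Nat.cast_one] at this
  simpa using mul_le_of_le_one_right (Real.rpow_nonneg hu.le (-r)) this

theorem hasDerivAt_tailIntegral_re {r : ℝ} (hr : 0 ≤ r) (c z t τ : ℝ)
    (hu : 0 < 1 + c * τ * z) :
    HasDerivAt (fun τ => (tailIntegral c r z t τ).re)
      (-(Real.cos (t + τ) * (1 + c * τ * z) ^ (-r))) τ := by
  have h := hasDerivAt_tailIntegral hr c z t τ hu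
  have h2 := Complex.reCLM.hasFDerivAt.comp_hasDerivAt τ h
  convert! h2 using 1
  have : Complex.exp (Complex.I * (t + τ)) = Complex.exp (((t + τ : ℝ) : ℂ) * Complex.I) := by
    push_cast; rw [mul_comm]
  rw [this, Complex.reCLM_apply, Complex.neg_re, Complex.re_mul_ofReal,
    Complex.exp_ofReal_mul_I_re]

theorem tailIntegral_zero_right (c r z t : ℝ) :
    tailIntegral c r z t 0 = Complex.I * Complex.exp (Complex.I * t) * laplaceInt c r 0 z := by
  simp [tailIntegral]

/-! ### The explicit flow and uniqueness of solutions -/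

/-- The smooth extension of `φ(·, t)` to the whole line, in Laplace form. -/
noncomputable def psi (N : ℕ) (a b t x : ℝ) : ℝ :=
  -x ^ (N + 1) * (Complex.I * Complex.exp (Complex.I * t) *
    laplaceInt (a * ((N : ℝ) - 1)) (sigma N a b) 0 (x ^ (N - 1))).re

section params

variable {N : ℕ} {a b : ℝ}

theorem natCast_sub_one_pos (hN : 2 ≤ N) : (0 : ℝ) < (N : ℝ) - 1 := by
  have : (2 : ℝ) ≤ N := by exact_mod_cast hN
  linarith

theorem one_lt_sigma (hN : 2 ≤ N) (ha : 0 < a) (hb : 0 < b) : 1 < sigma N a b := by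
  have h := natCast_sub_one_pos hN
  have h1 : 1 < ((N : ℝ) + 1) / ((N : ℝ) - 1) := by rw [lt_div_iff₀ h]; linarith
  have h2 : 0 < b / (a * ((N : ℝ) - 1)) := by positivity
  unfold sigma; linarith

theorem sigma_nonneg (hN : 2 ≤ N) (ha : 0 < a) (hb : 0 < b) : 0 ≤ sigma N a b := by
  linarith [one_lt_sigma hN ha hb]

/-- The factor `1 + a (N - 1) τ x^(N-1)` of the flow. -/
noncomputable def dil (N : ℕ) (a τ x : ℝ) : ℝ := 1 + a * ((N : ℝ) - 1) * τ * x ^ (N - 1)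

/-- The first component of the flow after time `τ`. -/
noncomputable def flowX (N : ℕ) (a τ x : ℝ) : ℝ := x * dil N a τ x ^ (-(1 / ((N : ℝ) - 1)))

/-- The second component of the flow from time `t` to time `t + τ`. -/
noncomputable def flowY (N : ℕ) (a b t τ : ℝ) (p : ℝ × ℝ) : ℝ :=
  dil N a τ p.1 ^ (b / (a * ((N : ℝ) - 1))) * (p.2 - psi N a b t p.1) +
    psi N a b (t + τ) (flowX N a τ p.1)

theorem dil_zero_left (x : ℝ) : dil N a 0 x = 1 := by simp [dil]

theorem flowX_zero_left (x : ℝ) : flowX N a 0 x = x := by simp [flowX, dil_zero_left]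

theorem flowY_zero_left (t : ℝ) (p : ℝ × ℝ) : flowY N a b t 0 p = p.2 := by
  simp [flowY, dil_zero_left, flowX_zero_left]

theorem dil_pos_of_pos (hN : 2 ≤ N) (ha : 0 < a) {τ x : ℝ} (hτ : 0 ≤ τ) (hx : 0 < x) :
    0 < dil N a τ x := by
  have := natCast_sub_one_pos hN
  unfold dil; positivity

/-- The dilation is affine in time with value `1` at time zero. The sign of `x^(N-1)` is not
assumed, because the Poincaré map is needed on a full neighbourhood of the origin. -/
theorem dil_pos_of_le {τ T x : ℝ} (hT : 0 < dil N a T x) (h0 : 0 ≤ τ) (hτ : τ ≤ T) :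
    0 < dil N a τ x := by
  unfold dil at *
  rcases le_or_gt 0 (a * ((N : ℝ) - 1) * x ^ (N - 1)) with h | h
  · nlinarith [mul_nonneg h0 h]
  · nlinarith [mul_nonneg (sub_nonneg.2 hτ) (neg_nonneg.2 h.le)]

/-- In the variable `z = x^(N-1)` the flow is the Möbius map `z ↦ z / (1 + c τ z)`, the very
argument that occurs in `tailIntegral`. -/
theorem flowX_pow (hN : 2 ≤ N) {τ x : ℝ} (h : 0 < dil N a τ x) :
    flowX N a τ x ^ (N - 1) = x ^ (N - 1) / dil N a τ x := by
  have h1 := natCast_sub_one_pos hN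
  unfold flowX
  rw [mul_pow, ← Real.rpow_natCast (dil N a τ x ^ _), ← Real.rpow_mul h.le, Nat.cast_pred (by omega),
    show -(1 / ((N : ℝ) - 1)) * ((N : ℝ) - 1) = -1 by field_simp, Real.rpow_neg_one]
  rfl

/-- This is where `σ` comes from: `-(N+1)/(N-1) = β - σ` with `β = b/(a(N-1))`. -/
theorem flowX_pow_succ (hN : 2 ≤ N) (ha : a ≠ 0) {τ x : ℝ} (h : 0 < dil N a τ x) :
    flowX N a τ x ^ (N + 1) =
      x ^ (N + 1) * (dil N a τ x ^ (b / (a * ((N : ℝ) - 1))) * dil N a τ x ^ (-sigma N a b)) := by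
  have h1 := natCast_sub_one_pos hN
  unfold flowX sigma
  rw [mul_pow, ← Real.rpow_natCast (dil N a τ x ^ _), ← Real.rpow_mul h.le, ← Real.rpow_add h]
  congr 2
  push_cast
  field_simp
  ring

theorem psi_flowX (hN : 2 ≤ N) (ha : a ≠ 0) {t τ x : ℝ} (h : 0 < dil N a τ x) :
    psi N a b (t + τ) (flowX N a τ x) =
      -x ^ (N + 1) * dil N a τ x ^ (b / (a * ((N : ℝ) - 1))) *
        (tailIntegral (a * ((N : ℝ) - 1)) (sigma N a b) (x ^ (N - 1)) t τ).re := by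
  unfold psi tailIntegral
  rw [flowX_pow_succ (b := b) hN ha h, flowX_pow hN h]
  change _ = _ * (_ * Complex.ofReal (dil N a τ x ^ (-sigma N a b)) *
    laplaceInt _ _ _ (_ / dil N a τ x)).re
  generalize laplaceInt _ _ _ _ = G
  rw [mul_right_comm (Complex.I * Complex.exp (Complex.I * (t + τ))) _ G, Complex.re_mul_ofReal]
  push_cast
  ring

/-- The variation of constants form. The defining form through `psi` displays invariance of the
graph; this one involves only an integral over a finite time, so it can be differentiated in `τ` and
is analytic in `x`. -/
theorem flowY_eq (hN : 2 ≤ N) (ha : a ≠ 0) {t τ : ℝ} {p : ℝ × ℝ} (h : 0 < dil N a τ p.1) :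
    flowY N a b t τ p = dil N a τ p.1 ^ (b / (a * ((N : ℝ) - 1))) *
      (p.2 + p.1 ^ (N + 1) *
        ((tailIntegral (a * ((N : ℝ) - 1)) (sigma N a b) (p.1 ^ (N - 1)) t 0).re -
          (tailIntegral (a * ((N : ℝ) - 1)) (sigma N a b) (p.1 ^ (N - 1)) t τ).re)) := by
  have h0 := psi_flowX (b := b) hN ha (t := t) (τ := 0) (x := p.1) (by simp [dil_zero_left])
  rw [add_zero, flowX_zero_left, dil_zero_left, Real.one_rpow] at h0
  rw [flowY, psi_flowX hN ha h, h0]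
  ring

theorem hasDerivAt_dil (x τ : ℝ) :
    HasDerivAt (fun τ => dil N a τ x) (a * ((N : ℝ) - 1) * x ^ (N - 1)) τ := by
  unfold dil
  simpa using (((hasDerivAt_id τ).const_mul (a * ((N : ℝ) - 1))).mul_const
    (x ^ (N - 1))).const_add 1

theorem hasDerivAt_flowX (hN : 2 ≤ N) {τ x : ℝ} (h : 0 < dil N a τ x) :
    HasDerivAt (fun τ => flowX N a τ x) (-a * flowX N a τ x ^ N) τ := by
  have h1 := natCast_sub_one_pos hN
  have hd := ((hasDerivAt_dil (N := N) (a := a) x τ).rpow_const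
    (p := -(1 / ((N : ℝ) - 1))) (Or.inl h.ne')).const_mul x
  convert! hd using 1
  have hpow : flowX N a τ x ^ N = flowX N a τ x ^ (N - 1) * flowX N a τ x := by
    rw [← pow_succ]; congr 1; omega
  rw [hpow, flowX_pow hN h, flowX, Real.rpow_sub_one h.ne']
  field_simp

theorem hasDerivAt_flowY (hN : 2 ≤ N) (ha : 0 < a) (hb : 0 < b) {t τ : ℝ} {p : ℝ × ℝ}
    (h : 0 < dil N a τ p.1) :
    HasDerivAt (fun τ => flowY N a b t τ p)
      (b * flowX N a τ p.1 ^ (N - 1) * flowY N a b t τ p +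
        flowX N a τ p.1 ^ (N + 1) * Real.cos (t + τ)) τ := by
  have h1 := natCast_sub_one_pos hN
  have hev : ∀ᶠ s in 𝓝 τ, 0 < dil N a s p.1 :=
    (hasDerivAt_dil p.1 τ).continuousAt.eventually (lt_mem_nhds h)
  refine HasDerivAt.congr_of_eventuallyEq ?_
    (hev.mono fun s hs => flowY_eq (t := t) (b := b) hN ha.ne' hs)
  have hd := (hasDerivAt_dil (N := N) (a := a) p.1 τ).rpow_const
    (p := b / (a * ((N : ℝ) - 1))) (Or.inl h.ne')
  have ht := hasDerivAt_tailIntegral_re (sigma_nonneg hN ha hb) (a * ((N : ℝ) - 1))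
    (p.1 ^ (N - 1)) t τ h
  convert! hd.mul ((((ht.const_sub (tailIntegral (a * ((N : ℝ) - 1)) (sigma N a b)
    (p.1 ^ (N - 1)) t 0).re).const_mul (p.1 ^ (N + 1)))).const_add p.2) using 1
  rw [flowX_pow hN h, flowX_pow_succ (b := b) hN ha.ne' h, flowY_eq hN ha.ne' h,
    Real.rpow_sub_one h.ne']
  have : 1 + a * ((N : ℝ) - 1) * τ * p.1 ^ (N - 1) = dil N a τ p.1 := rfl
  rw [this]
  field_simp

/-- The flow is a solution of the differential equation. -/
theorem isSolutionOn_flow (hN : 2 ≤ N) (ha : 0 < a) (hb : 0 < b) {t₀ : ℝ} {p : ℝ × ℝ} {s : Set ℝ}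
    (h : ∀ t ∈ s, 0 < dil N a (t - t₀) p.1) :
    IsSolutionOn (field N a b)
      (fun t => (flowX N a (t - t₀) p.1, flowY N a b t₀ (t - t₀) p)) s := by
  intro t ht
  have hs : HasDerivAt (fun t => t - t₀) 1 t := (hasDerivAt_id t).sub_const t₀
  have hx := (hasDerivAt_flowX hN (h t ht)).comp t hs
  have hy := (hasDerivAt_flowY hN ha hb (t := t₀) (h t ht)).comp t hs
  rw [mul_one] at hx hy
  rw [add_sub_cancel] at hy
  exact (hx.prodMk hy).hasDerivWithinAt

/-- Time enters only through the factor `cos t`, bounded by `1`, so the Lipschitz constant can be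
chosen independent of time. -/
theorem exists_lipschitzOnWith_field (N : ℕ) (a b : ℝ) {s : Set (ℝ × ℝ)} (hs : Convex ℝ s)
    (hc : IsCompact s) : ∃ K, ∀ t, LipschitzOnWith K (fun p => field N a b p t) s := by
  have hf : ContDiff ℝ 1 (fun p : ℝ × ℝ => ((-a * p.1 ^ N, b * p.1 ^ (N - 1) * p.2) : ℝ × ℝ)) := by
    fun_prop
  have hg : ContDiff ℝ 1 (fun p : ℝ × ℝ => ((0, p.1 ^ (N + 1)) : ℝ × ℝ)) := by
    fun_prop
  obtain ⟨K₁, h₁⟩ := hf.contDiffOn.exists_lipschitzOnWith one_ne_zero hs hc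
  obtain ⟨K₂, h₂⟩ := hg.contDiffOn.exists_lipschitzOnWith one_ne_zero hs hc
  refine ⟨K₁ + K₂, fun t => LipschitzOnWith.of_dist_le_mul fun p hp q hq => ?_⟩
  have e : ∀ p : ℝ × ℝ, field N a b p t = ((-a * p.1 ^ N, b * p.1 ^ (N - 1) * p.2) : ℝ × ℝ) +
      Real.cos t • ((0, p.1 ^ (N + 1)) : ℝ × ℝ) := by
    intro p; ext <;> simp [field]; ring
  simp only [e]
  have d1 := h₁.dist_le_mul p hp q hq
  have d2 := h₂.dist_le_mul p hp q hq
  refine (dist_add_add_le _ _ _ _).trans ?_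
  rw [dist_smul₀, NNReal.coe_add, add_mul]
  refine add_le_add d1 (le_trans ?_ d2)
  exact mul_le_of_le_one_left dist_nonneg (Real.abs_cos_le_one t)

/-- Uniqueness of solutions on a compact time interval. -/
theorem eqOn_of_isSolutionOn {t₀ T : ℝ} {ξ η : ℝ → ℝ × ℝ}
    (hξ : IsSolutionOn (field N a b) ξ (Icc t₀ T)) (hη : IsSolutionOn (field N a b) η (Icc t₀ T))
    (h0 : ξ t₀ = η t₀) : EqOn ξ η (Icc t₀ T) := by
  have cξ : ContinuousOn ξ (Icc t₀ T) := fun t ht => (hξ t ht).continuousWithinAt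
  have cη : ContinuousOn η (Icc t₀ T) := fun t ht => (hη t ht).continuousWithinAt
  -- The field is not globally Lipschitz. Both trajectories are compact, hence lie in a common ball
  -- on which it is.
  obtain ⟨R, hR⟩ := ((isCompact_Icc.image_of_continuousOn cξ).isBounded.union
    (isCompact_Icc.image_of_continuousOn cη).isBounded).subset_closedBall 0
  obtain ⟨K, hK⟩ := exists_lipschitzOnWith_field N a b (convex_closedBall (0 : ℝ × ℝ) R)
    (isCompact_closedBall 0 R)
  have up : ∀ {ζ : ℝ → ℝ × ℝ}, IsSolutionOn (field N a b) ζ (Icc t₀ T) →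
      ∀ t ∈ Ico t₀ T, HasDerivWithinAt ζ (field N a b (ζ t) t) (Ici t) t := by
    intro ζ hζ t ht
    refine (hζ t ⟨ht.1, ht.2.le⟩).mono_of_mem_nhdsWithin ?_
    exact mem_of_superset (Icc_mem_nhdsGE ht.2) (Icc_subset_Icc_left ht.1)
  exact ODE_solution_unique_of_mem_Icc_right (v := fun t p => field N a b p t)
    (s := fun _ => Metric.closedBall 0 R) (fun t _ => hK t) cξ (up hξ)
    (fun t ht => hR (Or.inl ⟨t, ⟨ht.1, ht.2.le⟩, rfl⟩)) cη (up hη)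
    (fun t ht => hR (Or.inr ⟨t, ⟨ht.1, ht.2.le⟩, rfl⟩)) h0

theorem eq_flow_of_isSolutionOn (hN : 2 ≤ N) (ha : 0 < a) (hb : 0 < b) {t₀ T : ℝ} (hT : 0 ≤ T)
    {p : ℝ × ℝ} (hp : 0 < dil N a T p.1) {ξ : ℝ → ℝ × ℝ}
    (hξ : IsSolutionOn (field N a b) ξ (Icc t₀ (t₀ + T))) (h0 : ξ t₀ = p) :
    ξ (t₀ + T) = (flowX N a T p.1, flowY N a b t₀ T p) := by
  have hf := isSolutionOn_flow (t₀ := t₀) (p := p) (s := Icc t₀ (t₀ + T)) hN ha hb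
    (fun t ht => dil_pos_of_le hp (by linarith [ht.1]) (by linarith [ht.2]))
  have := eqOn_of_isSolutionOn hξ hf (by simp [h0, flowX_zero_left, flowY_zero_left])
    (right_mem_Icc.2 (by linarith))
  simpa using this

theorem solvableFrom_of_dil_pos (hN : 2 ≤ N) (ha : 0 < a) (hb : 0 < b) (t₀ : ℝ) {T : ℝ}
    {p : ℝ × ℝ} (hp : 0 < dil N a T p.1) : SolvableFrom (field N a b) t₀ T p :=
  ⟨_, isSolutionOn_flow (t₀ := t₀) (p := p) (s := Icc t₀ (t₀ + T)) hN ha hb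
    (fun t ht => dil_pos_of_le hp (by linarith [ht.1]) (by linarith [ht.2])),
    by simp [flowX_zero_left, flowY_zero_left]⟩

/-- By uniqueness, the solution chosen in the definition is the explicit flow. -/
theorem stroboscopicMap_eq_flow (hN : 2 ≤ N) (ha : 0 < a) (hb : 0 < b) (t₀ : ℝ) {T : ℝ}
    (hT : 0 ≤ T) {p : ℝ × ℝ} (hp : 0 < dil N a T p.1) :
    stroboscopicMap (field N a b) t₀ T p = (flowX N a T p.1, flowY N a b t₀ T p) := by
  have hs := solvableFrom_of_dil_pos hN ha hb t₀ hp
  unfold stroboscopicMap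
  rw [dif_pos hs]
  exact eq_flow_of_isSolutionOn hN ha hb hT hp hs.choose_spec.1 hs.choose_spec.2

end params

/-! ### The integral formula and the stable manifold of the flow -/

section params

variable {N : ℕ} {a b : ℝ}

theorem integrand_eq {x t τ : ℝ} (hu : 0 ≤ 1 + a * ((N : ℝ) - 1) * τ * x ^ (N - 1)) :
    integrand N a b x t τ =
      Real.cos (t + τ) * (1 + a * ((N : ℝ) - 1) * τ * x ^ (N - 1)) ^ (-sigma N a b) := by
  rw [integrand, Real.rpow_neg hu, div_eq_mul_inv]

theorem integrableOn_integrand (hN : 2 ≤ N) (ha : 0 < a) (hb : 0 < b) {x : ℝ} (t : ℝ)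
    (hx : 0 < x) : IntegrableOn (integrand N a b x t) (Ioi 0) := by
  have h1 := natCast_sub_one_pos hN
  set κ := a * ((N : ℝ) - 1) * x ^ (N - 1) with hκ
  have hκ0 : 0 < κ := by positivity
  -- Since `σ > 1`, the power `(κ (τ + 1/κ))^(-σ) = (1 + κ τ)^(-σ)` is an integrable majorant.
  have hi : IntegrableOn (fun τ : ℝ => κ ^ (-sigma N a b) * (τ + 1 / κ) ^ (-sigma N a b)) (Ioi 0) :=
    (integrableOn_add_rpow_Ioi_of_lt (by linarith [one_lt_sigma hN ha hb])
      (by simpa using hκ0)).const_mul _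
  have hmul : ∀ τ : ℝ, 1 + a * ((N : ℝ) - 1) * τ * x ^ (N - 1) = κ * (τ + 1 / κ) := by
    intro τ; rw [mul_add, mul_one_div_cancel hκ0.ne']; ring
  refine hi.mono' ?_ ?_
  · refine ContinuousOn.aestronglyMeasurable (fun τ hτ => ?_) measurableSet_Ioi
    have hτ' : (0 : ℝ) < τ := hτ
    have hp : 0 < 1 + a * ((N : ℝ) - 1) * τ * x ^ (N - 1) := by positivity
    have hc : ContinuousAt (fun τ : ℝ => 1 + a * ((N : ℝ) - 1) * τ * x ^ (N - 1)) τ := by fun_prop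
    have h2 := hc.rpow_const (p := sigma N a b) (Or.inl hp.ne')
    exact (ContinuousAt.div (by fun_prop) h2 (Real.rpow_pos_of_pos hp _).ne').continuousWithinAt
  · refine (ae_restrict_iff' measurableSet_Ioi).2 (Eventually.of_forall fun τ hτ => ?_)
    have hτ' : (0 : ℝ) < τ := hτ
    have hp : 0 < 1 + a * ((N : ℝ) - 1) * τ * x ^ (N - 1) := by positivity
    rw [integrand_eq hp.le, norm_mul, hmul, ← Real.mul_rpow hκ0.le (by positivity),
      Real.norm_of_nonneg (Real.rpow_nonneg (by positivity) _)]
    exact mul_le_of_le_one_left (Real.rpow_nonneg (by positivity) _) (Real.abs_cos_le_one _)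

theorem phi_add_two_pi (x t : ℝ) : phi N a b x (t + 2 * Real.pi) = phi N a b x t := by
  unfold phi integrand
  simp_rw [show ∀ τ : ℝ, t + 2 * Real.pi + τ = t + τ + 2 * Real.pi from fun τ => by ring,
    Real.cos_add_two_pi]

theorem psi_add_two_pi (x t : ℝ) : psi N a b (t + 2 * Real.pi) x = psi N a b t x := by
  unfold psi
  have : Complex.I * ((t + 2 * Real.pi : ℝ) : ℂ) = Complex.I * t + 2 * Real.pi * Complex.I := by
    push_cast; ring
  rw [this, Complex.exp_periodic]

theorem psi_add_nat_mul_two_pi (j : ℕ) (x t : ℝ) :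
    psi N a b (t + j * (2 * Real.pi)) x = psi N a b t x := by
  induction j with
  | zero => simp
  | succ j ih => rw [Nat.cast_succ, add_mul, one_mul, ← add_assoc, psi_add_two_pi, ih]

theorem tendsto_dil_atTop (hN : 2 ≤ N) (ha : 0 < a) {x : ℝ} (hx : 0 < x) :
    Tendsto (fun τ => dil N a τ x) atTop atTop := by
  have h1 := natCast_sub_one_pos hN
  unfold dil
  refine tendsto_atTop_add_const_left _ _ (Tendsto.atTop_mul_const (by positivity) ?_)
  exact tendsto_id.const_mul_atTop (by positivity)

/-- The negative real part of `tailIntegral` is a primitive of the integrand and vanishes at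
infinity, so the integral equals its value at `τ = 0`. -/
theorem phi_eq_psi_of_pos (hN : 2 ≤ N) (ha : 0 < a) (hb : 0 < b) {x : ℝ} (t : ℝ) (hx : 0 < x) :
    phi N a b x t = psi N a b t x := by
  have h1 := natCast_sub_one_pos hN
  have hs := sigma_nonneg hN ha hb
  have hpos : ∀ τ : ℝ, 0 ≤ τ → 0 < 1 + a * ((N : ℝ) - 1) * τ * x ^ (N - 1) :=
    fun τ hτ => dil_pos_of_pos hN ha hτ hx
  have key := integral_Ioi_of_hasDerivAt_of_tendsto' (a := (0 : ℝ)) (m := 0)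
    (f := fun τ => -(tailIntegral (a * ((N : ℝ) - 1)) (sigma N a b) (x ^ (N - 1)) t τ).re)
    (f' := integrand N a b x t) ?_ (integrableOn_integrand hN ha hb t hx) ?_
  · rw [phi, key, tailIntegral_zero_right, psi, zero_sub, neg_neg]
  · intro τ hτ
    rw [integrand_eq (hpos τ hτ).le]
    have h := (hasDerivAt_tailIntegral_re hs (a * ((N : ℝ) - 1)) (x ^ (N - 1)) t τ
      (hpos τ hτ)).neg
    rwa [neg_neg] at h
  · have ht : Tendsto (fun τ : ℝ => (dil N a τ x) ^ (-sigma N a b)) atTop (𝓝 0) :=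
      (tendsto_rpow_neg_atTop (by linarith [one_lt_sigma hN ha hb])).comp
        (tendsto_dil_atTop hN ha hx)
    refine squeeze_zero_norm' ?_ ht
    filter_upwards [eventually_ge_atTop 0] with τ hτ
    rw [norm_neg]
    exact (Complex.abs_re_le_norm _).trans (norm_tailIntegral_le hs _ _ t (hpos τ hτ))

theorem psi_zero (t : ℝ) : psi N a b t 0 = 0 := by simp [psi]

theorem phi_eq_psi (hN : 2 ≤ N) (ha : 0 < a) (hb : 0 < b) {x : ℝ} (t : ℝ) (hx : 0 ≤ x) :
    phi N a b x t = psi N a b t x := by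
  rcases hx.eq_or_lt with rfl | hx
  · simp [phi, psi]
  · exact phi_eq_psi_of_pos hN ha hb t hx

theorem abs_psi_le (hN : 2 ≤ N) (ha : 0 < a) (hb : 0 < b) (t x : ℝ) :
    |psi N a b t x| ≤ |x| ^ (N + 1) := by
  unfold psi
  rw [abs_mul, abs_neg, abs_pow]
  refine mul_le_of_le_one_right (by positivity) ((Complex.abs_re_le_norm _).trans ?_)
  have h1 : ‖Complex.exp (Complex.I * t)‖ = 1 := by rw [Complex.norm_exp]; simp
  rw [norm_mul, norm_mul, Complex.norm_I, h1, one_mul, one_mul]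
  simpa using norm_laplaceInt_le (sigma_nonneg hN ha hb) (a * ((N : ℝ) - 1)) 0 (x ^ (N - 1))

theorem contDiff_psi (hN : 2 ≤ N) (ha : 0 < a) (hb : 0 < b) (t : ℝ) :
    ContDiff ℝ (⊤ : ℕ∞) (psi N a b t) := by
  have hG := (contDiff_infty_laplaceInt (a * ((N : ℝ) - 1)) (sigma_nonneg hN ha hb) 0).comp
    (contDiff_id.pow (N - 1))
  have h2 := Complex.reCLM.contDiff.comp
    (contDiff_const (c := Complex.I * Complex.exp (Complex.I * t)) |>.mul hG)
  exact ((contDiff_id.pow (N + 1)).neg).mul h2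

theorem contDiffOn_phi (hN : 2 ≤ N) (ha : 0 < a) (hb : 0 < b) (t : ℝ) :
    ContDiffOn ℝ (⊤ : ℕ∞) (fun x => phi N a b x t) (Ici 0) :=
  (contDiff_psi hN ha hb t).contDiffOn.congr fun _ hx => phi_eq_psi hN ha hb t hx

theorem one_le_dil (hN : 2 ≤ N) (ha : 0 < a) {τ x : ℝ} (hτ : 0 ≤ τ) (hx : 0 < x) :
    1 ≤ dil N a τ x := by
  have := natCast_sub_one_pos hN
  unfold dil
  linarith [show 0 ≤ a * ((N : ℝ) - 1) * τ * x ^ (N - 1) by positivity]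

theorem flowX_pos (hN : 2 ≤ N) (ha : 0 < a) {τ x : ℝ} (hτ : 0 ≤ τ) (hx : 0 < x) :
    0 < flowX N a τ x :=
  mul_pos hx (Real.rpow_pos_of_pos (dil_pos_of_pos hN ha hτ hx) _)

theorem flowX_le (hN : 2 ≤ N) (ha : 0 < a) {τ x : ℝ} (hτ : 0 ≤ τ) (hx : 0 < x) :
    flowX N a τ x ≤ x := by
  have := natCast_sub_one_pos hN
  refine mul_le_of_le_one_right hx.le
    (Real.rpow_le_one_of_one_le_of_nonpos (one_le_dil hN ha hτ hx) ?_)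
  rw [neg_nonpos]; positivity

theorem tendsto_flowX (hN : 2 ≤ N) (ha : 0 < a) {x : ℝ} (hx : 0 < x) :
    Tendsto (fun τ => flowX N a τ x) atTop (𝓝 0) := by
  have := natCast_sub_one_pos hN
  have h := ((tendsto_rpow_neg_atTop (y := 1 / ((N : ℝ) - 1)) (by positivity)).comp
    (tendsto_dil_atTop hN ha hx)).const_mul x
  rwa [mul_zero] at h

theorem tendsto_psi_flowX (hN : 2 ≤ N) (ha : 0 < a) (hb : 0 < b) (t : ℝ) {x : ℝ} (hx : 0 < x) :
    Tendsto (fun τ => psi N a b (t + τ) (flowX N a τ x)) atTop (𝓝 0) := by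
  have h := ((tendsto_flowX hN ha hx).abs).pow (N + 1)
  rw [abs_zero, zero_pow (by omega)] at h
  exact squeeze_zero_norm (fun τ => abs_psi_le hN ha hb _ _) h

/-- The stable set of the origin is the graph of `φ`. -/
theorem stableSet_field (hN : 2 ≤ N) (ha : 0 < a) (hb : 0 < b) (t₀ : ℝ) :
    stableSet (field N a b) t₀ = {p | 0 < p.1 ∧ p.2 = phi N a b p.1 t₀} := by
  have h1 := natCast_sub_one_pos hN
  ext p
  constructor
  · rintro ⟨hp, ξ, hξ, h0, hlim⟩
    refine ⟨hp, ?_⟩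
    rw [phi_eq_psi_of_pos hN ha hb t₀ hp]
    have hflow : ∀ T : ℝ, 0 ≤ T → ξ (t₀ + T) = (flowX N a T p.1, flowY N a b t₀ T p) :=
      fun T hT => eq_flow_of_isSolutionOn hN ha hb hT (dil_pos_of_pos hN ha hT hp)
        (fun t ht => (hξ t ht.1).mono fun s hs => hs.1) h0
    have hl := (continuous_snd.tendsto (0 : ℝ × ℝ)).comp
      (hlim.comp (tendsto_atTop_add_const_left _ t₀ tendsto_id))
    have hl2 := (hl.sub (tendsto_psi_flowX hN ha hb t₀ hp)).abs
    -- The distance to the graph is multiplied by a power of the dilation, which is at least `1`. It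
    -- cannot decrease, yet it must tend to zero.
    have : |p.2 - psi N a b t₀ p.1| ≤ 0 := by
      refine le_of_tendsto_of_tendsto tendsto_const_nhds (hl2.trans (by simp)) ?_
      filter_upwards [eventually_ge_atTop 0] with T hT
      simp only [Function.comp_apply, id, hflow T hT, flowY, add_sub_cancel_right]
      rw [abs_mul]
      refine le_mul_of_one_le_left (abs_nonneg _) ?_
      exact (Real.one_le_rpow (one_le_dil hN ha hT hp) (by positivity)).trans (le_abs_self _)
    linarith [abs_nonpos_iff.1 this]
  · rintro ⟨hp, hy⟩
    refine ⟨hp, _, isSolutionOn_flow (t₀ := t₀) (p := p) (s := Ici t₀) hN ha hb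
      (fun t ht => dil_pos_of_pos hN ha (sub_nonneg.2 ht) hp),
      by simp [flowX_zero_left, flowY_zero_left], ?_⟩
    have ht : Tendsto (fun t : ℝ => t - t₀) atTop atTop :=
      tendsto_atTop_add_const_right _ _ tendsto_id
    refine Tendsto.prodMk_nhds ((tendsto_flowX hN ha hp).comp ht) ?_
    refine Tendsto.congr (fun t => ?_) ((tendsto_psi_flowX hN ha hb t₀ hp).comp ht)
    rw [phi_eq_psi_of_pos hN ha hb t₀ hp] at hy
    simp [flowY, hy]

/-! ### Iterates of the Poincaré map and its local stable manifold -/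

theorem dil_add (hN : 2 ≤ N) {τ s x : ℝ} (h : 0 < dil N a τ x) :
    dil N a (τ + s) x = dil N a τ x * dil N a s (flowX N a τ x) := by
  rw [dil.eq_def N a s, flowX_pow hN h, mul_add, mul_one, mul_div_assoc', mul_div_cancel₀ _ h.ne']
  unfold dil
  ring

theorem flowX_add (hN : 2 ≤ N) {τ s x : ℝ} (h : 0 < dil N a τ x)
    (h' : 0 < dil N a s (flowX N a τ x)) :
    flowX N a (τ + s) x = flowX N a s (flowX N a τ x) := by
  rw [flowX, dil_add hN h, Real.mul_rpow h.le h'.le, flowX.eq_def N a s, ← mul_assoc]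
  rfl

theorem flowY_add (hN : 2 ≤ N) {t τ s : ℝ} {p : ℝ × ℝ} (h : 0 < dil N a τ p.1)
    (h' : 0 < dil N a s (flowX N a τ p.1)) :
    flowY N a b t (τ + s) p =
      flowY N a b (t + τ) s (flowX N a τ p.1, flowY N a b t τ p) := by
  simp only [flowY]
  rw [flowX_add hN h h', dil_add hN h, Real.mul_rpow h.le h'.le]
  ring_nf

theorem iterate_stroboscopicMap (hN : 2 ≤ N) (ha : 0 < a) (hb : 0 < b) (t₀ : ℝ) {p : ℝ × ℝ}
    (hp : 0 < p.1) (k : ℕ) :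
    (stroboscopicMap (field N a b) t₀ (2 * Real.pi))^[k] p =
      (flowX N a (k * (2 * Real.pi)) p.1, flowY N a b t₀ (k * (2 * Real.pi)) p) := by
  have hpi := Real.pi_pos
  induction k with
  | zero => simp [flowX_zero_left, flowY_zero_left]
  | succ k ih =>
    have hk : (0 : ℝ) ≤ k * (2 * Real.pi) := by positivity
    have hX := flowX_pos hN ha hk hp
    have hd := dil_pos_of_pos hN ha hk hp
    have hd' := dil_pos_of_pos hN ha (τ := 2 * Real.pi) (by positivity) hX
    rw [Function.iterate_succ_apply', ih,
      stroboscopicMap_eq_flow hN ha hb t₀ (by positivity) hd', Nat.cast_succ, add_mul, one_mul,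
      flowX_add hN hd hd', flowY_add hN hd hd']
    -- Periodicity of `psi` makes the flow over one period the same from time `t₀ + 2πk` as from
    -- time `t₀`.
    simp only [flowY, psi_add_nat_mul_two_pi, psi_add_two_pi]

/-- Along the graph the distance to the origin increases with small `x > 0`. As the flow decreases
`x`, orbits on the graph never leave a small disc. -/
theorem exists_disc_monotone_psi (hN : 2 ≤ N) (ha : 0 < a) (hb : 0 < b) (t : ℝ) :
    ∃ ρ₀ : ℝ, 0 < ρ₀ ∧ ∀ x y : ℝ, 0 < x → x ≤ y → y ≤ ρ₀ →
      x ^ 2 + psi N a b t x ^ 2 ≤ y ^ 2 + psi N a b t y ^ 2 := by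
  obtain ⟨K, hK⟩ := (contDiff_psi hN ha hb t).contDiffOn.exists_lipschitzOnWith
    (s := Icc (0 : ℝ) 1) (by simp) (convex_Icc 0 1) isCompact_Icc
  have hK0 : (0 : ℝ) ≤ K := K.2
  -- For `0 < x ≤ y ≤ 1`, the Lipschitz bound and `|ψ(z)| ≤ y z` for `z = x, y` give `ψ(x)² - ψ(y)²
  -- ≤ K y (y² - x²)`; it remains to have `K y ≤ 1`.
  refine ⟨min 1 (1 / (K + 1)), by positivity, fun x y hx hxy hy => ?_⟩
  have hy1 : y ≤ 1 := hy.trans (min_le_left _ _)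
  have hy2 : y * (K + 1) ≤ 1 := by
    have := hy.trans (min_le_right _ _)
    rwa [le_div_iff₀ (by positivity)] at this
  have hy0 : 0 < y := hx.trans_le hxy
  have hlip := hK.dist_le_mul x ⟨hx.le, hxy.trans hy1⟩ y ⟨hy0.le, hy1⟩
  rw [Real.dist_eq, Real.dist_eq, abs_sub_comm x y, abs_of_nonneg (sub_nonneg.2 hxy)] at hlip
  have hb : ∀ z : ℝ, 0 < z → z ≤ y → |psi N a b t z| ≤ y * z := by
    intro z hz hzy
    refine (abs_psi_le hN ha hb t z).trans ?_
    rw [abs_of_pos hz, pow_succ]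
    refine mul_le_mul_of_nonneg_right ?_ hz.le
    exact (pow_le_of_le_one hz.le (hzy.trans hy1) (by omega)).trans hzy
  have h1 := hb x hx hxy
  have h2 := hb y hy0 le_rfl
  have h3 : psi N a b t x ^ 2 - psi N a b t y ^ 2 ≤ K * (y - x) * (y * x + y * y) := by
    calc psi N a b t x ^ 2 - psi N a b t y ^ 2
        = (psi N a b t x - psi N a b t y) * (psi N a b t x + psi N a b t y) := by ring
      _ ≤ |psi N a b t x - psi N a b t y| * |psi N a b t x + psi N a b t y| := by
          rw [← abs_mul]; exact le_abs_self _
      _ ≤ K * (y - x) * (y * x + y * y) := by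
          refine mul_le_mul hlip ((abs_add_le _ _).trans (add_le_add h1 h2)) (abs_nonneg _) ?_
          exact mul_nonneg hK0 (sub_nonneg.2 hxy)
  have h4 : K * (y - x) * (y * x + y * y) = (K * y) * ((y - x) * (x + y)) := by ring
  have h5 : (K * y) * ((y - x) * (x + y)) ≤ 1 * ((y - x) * (x + y)) := by
    refine mul_le_mul_of_nonneg_right (by nlinarith) ?_
    exact mul_nonneg (sub_nonneg.2 hxy) (by positivity)
  nlinarith

/-- The local stable manifold of the stroboscopic map is the graph of `φ`. -/
theorem localStableManifold_stroboscopicMap (hN : 2 ≤ N) (ha : 0 < a) (hb : 0 < b) (t₀ : ℝ) :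
    ∃ ρ₀ : ℝ, 0 < ρ₀ ∧ ∀ ρ : ℝ, 0 < ρ → ρ ≤ ρ₀ →
      localStableManifold (stroboscopicMap (field N a b) t₀ (2 * Real.pi)) ρ =
        {p | p ∈ disc ρ ∧ 0 < p.1 ∧ p.2 = phi N a b p.1 t₀} := by
  have h1 := natCast_sub_one_pos hN
  have hpi := Real.pi_pos
  obtain ⟨ρ₀, hρ₀, hmono⟩ := exists_disc_monotone_psi hN ha hb t₀
  refine ⟨ρ₀, hρ₀, fun ρ hρ hρρ => ?_⟩
  ext p
  constructor
  · intro hp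
    obtain ⟨hd, hx⟩ := hp 0
    simp only [Function.iterate_zero, id] at hd hx
    refine ⟨hd, hx, ?_⟩
    rw [phi_eq_psi_of_pos hN ha hb t₀ hx]
    by_contra hne
    have hne' : 0 < |p.2 - psi N a b t₀ p.1| := abs_pos.2 (sub_ne_zero.2 hne)
    have htend : Tendsto (fun k : ℕ => dil N a (k * (2 * Real.pi)) p.1 ^
        (b / (a * ((N : ℝ) - 1))) * |p.2 - psi N a b t₀ p.1|) atTop atTop := by
      refine Tendsto.atTop_mul_const hne' ((tendsto_rpow_atTop (by positivity)).comp
        ((tendsto_dil_atTop hN ha hx).comp ?_))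
      exact tendsto_natCast_atTop_atTop.atTop_mul_const (by positivity)
    -- In the disc both coordinates are at most `ρ` in modulus, so the distance to the graph is at
    -- most `ρ + ρ^(N+1)`; off the graph its growth eventually violates this.
    obtain ⟨k, hk⟩ := (htend.eventually_gt_atTop (ρ + ρ ^ (N + 1))).exists
    have hk0 : (0 : ℝ) ≤ k * (2 * Real.pi) := by positivity
    obtain ⟨hdk, -⟩ := hp k
    rw [iterate_stroboscopicMap hN ha hb t₀ hx] at hdk
    simp only [disc, mem_ofPred_eq] at hdk
    set X := flowX N a (k * (2 * Real.pi)) p.1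
    set Y := flowY N a b t₀ (k * (2 * Real.pi)) p with hY
    have hXρ : |X| ≤ ρ := abs_le_of_sq_le_sq (by nlinarith [sq_nonneg Y]) hρ.le
    have hYρ : |Y| ≤ ρ := abs_le_of_sq_le_sq (by nlinarith [sq_nonneg X]) hρ.le
    have hψ : |psi N a b t₀ X| ≤ ρ ^ (N + 1) :=
      (abs_psi_le hN ha hb t₀ X).trans (pow_le_pow_left₀ (abs_nonneg _) hXρ _)
    have hYe : dil N a (k * (2 * Real.pi)) p.1 ^ (b / (a * ((N : ℝ) - 1))) *
        (p.2 - psi N a b t₀ p.1) = Y - psi N a b t₀ X := by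
      rw [hY, flowY, psi_add_nat_mul_two_pi]; ring
    have hDpos := Real.rpow_nonneg (dil_pos_of_pos hN ha hk0 hx).le (b / (a * ((N : ℝ) - 1)))
    have := congrArg abs hYe
    rw [abs_mul, abs_of_nonneg hDpos] at this
    linarith [abs_sub Y (psi N a b t₀ X)]
  · rintro ⟨hd, hx, hy⟩ k
    rw [phi_eq_psi_of_pos hN ha hb t₀ hx] at hy
    have hk0 : (0 : ℝ) ≤ k * (2 * Real.pi) := by positivity
    rw [iterate_stroboscopicMap hN ha hb t₀ hx]
    refine ⟨?_, flowX_pos hN ha hk0 hx⟩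
    simp only [disc, mem_ofPred_eq, flowY, hy, sub_self, mul_zero, zero_add, psi_add_nat_mul_two_pi] at hd ⊢
    have hp1 : p.1 ≤ ρ := abs_le_of_sq_le_sq' (by nlinarith [sq_nonneg (psi N a b t₀ p.1)]) hρ.le |>.2
    exact (hmono _ _ (flowX_pos hN ha hk0 hx) (flowX_le hN ha hk0 hx) (hp1.trans hρρ)).trans_lt hd

end params

/-! ### Taylor expansions and factorial comparisons -/

/-- A polynomial that is `O(tⁿ)` on one side of the origin is divisible by `Xⁿ`. -/
theorem X_pow_dvd_of_isBigO {P : Polynomial ℝ} {n : ℕ}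
    (h : (fun t => P.eval t) =O[𝓝[>] 0] fun t : ℝ => t ^ n) : Polynomial.X ^ n ∣ P := by
  by_cases hP : P = 0
  · simp [hP]
  obtain ⟨Q, hQ, hQ'⟩ := Polynomial.exists_eq_pow_rootMultiplicity_mul_and_not_dvd P hP 0
  simp only [map_zero, sub_zero] at hQ hQ'
  rw [Polynomial.X_dvd_iff, Polynomial.coeff_zero_eq_eval_zero] at hQ'
  set k := P.rootMultiplicity 0
  by_contra hnd
  have hkn : k < n := by
    by_contra hle
    exact hnd (hQ ▸ (pow_dvd_pow _ (not_lt.1 hle)).mul_right Q)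
  apply hQ'
  -- After division by `t^k` the cofactor is still `O(t^(n-k))` with `n - k > 0`, so it vanishes at
  -- zero.
  have h1 : (fun t => Q.eval t) =O[𝓝[>] 0] fun t : ℝ => t ^ (n - k) := by
    obtain ⟨C, hC⟩ := h.bound
    refine Asymptotics.IsBigO.of_bound C ?_
    filter_upwards [hC, self_mem_nhdsWithin] with t ht htpos
    have htpos' : (0 : ℝ) < t := htpos
    rw [hQ] at ht
    simp only [Polynomial.eval_mul, Polynomial.eval_pow, Polynomial.eval_X, norm_mul] at ht
    have e : t ^ n = t ^ k * t ^ (n - k) := by rw [← pow_add]; congr 1; omega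
    rw [e, norm_mul, mul_left_comm] at ht
    exact le_of_mul_le_mul_left ht (norm_pos_iff.2 (pow_pos htpos' k).ne')
  have h2 : Tendsto (fun t : ℝ => t ^ (n - k)) (𝓝[>] 0) (𝓝 0) := by
    have : Tendsto (fun t : ℝ => t ^ (n - k)) (𝓝 0) (𝓝 (0 ^ (n - k))) :=
      (continuous_pow (n - k)).tendsto 0
    rw [zero_pow (by omega)] at this
    exact this.mono_left nhdsWithin_le_nhds
  have h3 := h1.trans_tendsto h2
  have h4 : Tendsto (fun t => Q.eval t) (𝓝[>] 0) (𝓝 (Q.eval 0)) :=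
    (Q.continuous.tendsto 0).mono_left nhdsWithin_le_nhds
  exact tendsto_nhds_unique h4 h3

theorem pow_isBigO_pow {m n : ℕ} (h : m ≤ n) :
    (fun t : ℝ => t ^ n) =O[𝓝 0] fun t : ℝ => t ^ m := by
  refine Asymptotics.IsBigO.of_bound 1 ?_
  filter_upwards [Metric.ball_mem_nhds (0 : ℝ) one_pos] with t ht
  rw [one_mul, norm_pow, norm_pow]
  rw [mem_ball_zero_iff] at ht
  exact pow_le_pow_of_le_one (norm_nonneg _) ht.le h

/-- Taylor's formula at the origin with a big-O remainder. -/
theorem taylor_isBigO {E : Type*} [NormedAddCommGroup E] [NormedSpace ℝ E] {f : ℝ → E}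
    (hf : ContDiff ℝ (⊤ : ℕ∞) f) (n : ℕ) :
    (fun x => f x - ∑ k ∈ Finset.range n, x ^ k • ((k.factorial : ℝ)⁻¹ • iteratedDeriv k f 0))
      =O[𝓝 0] fun x : ℝ => x ^ n := by
  have h := (taylor_isLittleO_univ (x₀ := 0) (n := n) (hf.of_le (by exact_mod_cast le_top))).isBigO
  simp only [sub_zero, taylor_within_apply, iteratedDerivWithin_univ] at h
  have h2 : (fun x : ℝ => x ^ n • ((n.factorial : ℝ)⁻¹ • iteratedDeriv n f 0)) =O[𝓝 0]
      fun x : ℝ => x ^ n := by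
    simpa using (Asymptotics.isBigO_refl (fun x : ℝ => x ^ n) (𝓝 0)).smul
      (Asymptotics.isBigO_const_const ((n.factorial : ℝ)⁻¹ • iteratedDeriv n f 0)
        (one_ne_zero (α := ℝ)) (𝓝 (0 : ℝ)))
  refine (h.add h2).congr_left fun x => ?_
  rw [Finset.sum_range_succ, ← sub_sub]
  simp only [smul_smul, mul_comm (x ^ _)]
  abel

/-- With `factorial_mul_le_pow_mul` this shows that `(m j)!` and `(j!)^m` agree up to a geometric
factor, which converts growth in `j` into growth in `n`. -/
theorem factorial_pow_le_factorial_mul (m j : ℕ) : j.factorial ^ m ≤ (m * j).factorial := by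
  have h := Nat.prod_factorial_dvd_factorial_sum (Finset.range m) (fun _ => j)
  simp only [Finset.prod_const, Finset.card_range, Finset.sum_const, smul_eq_mul] at h
  exact Nat.le_of_dvd (Nat.factorial_pos _) h

theorem factorial_mul_le_pow_mul (m j : ℕ) :
    (m * j).factorial ≤ m ^ (m * j) * j.factorial ^ m := by
  induction j with
  | zero => simp
  | succ j ih =>
    calc (m * (j + 1)).factorial = (m * j).factorial * (m * j + 1).ascFactorial m := by
          rw [Nat.factorial_mul_ascFactorial, mul_add, mul_one]
      _ ≤ (m ^ (m * j) * j.factorial ^ m) * (m * j + m) ^ m :=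
          Nat.mul_le_mul ih (Nat.ascFactorial_le_pow_add _ _)
      _ = m ^ (m * (j + 1)) * (j + 1).factorial ^ m := by
          rw [Nat.factorial_succ, show m * j + m = m * (j + 1) by ring, mul_pow, mul_pow, mul_add,
            pow_add]
          ring

/-- Here `48 = 3! · 2³`, from `C(j+3, 3) ≤ 2^(j+3)`. The shift by three is used because `N + 1 ≤ 3(N
- 1)`. -/
theorem factorial_add_three_le (j : ℕ) : (j + 3).factorial ≤ 48 * 2 ^ j * j.factorial := by
  have h := Nat.choose_le_two_pow (j + 3) 3
  have h2 := Nat.choose_mul_factorial_mul_factorial (n := j + 3) (k := 3) (by omega)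
  rw [← h2, Nat.add_sub_cancel, show Nat.factorial 3 = 6 from rfl]
  refine Nat.mul_le_mul_right _ ?_
  calc (j + 3).choose 3 * 6 ≤ 2 ^ (j + 3) * 6 := Nat.mul_le_mul_right _ h
    _ = 48 * 2 ^ j := by ring

/-! ### Taylor coefficients of `φ` and their exact Gevrey order -/

section params

variable {N : ℕ} {a b : ℝ}

theorem taylorCoeff_phi (hN : 2 ≤ N) (ha : 0 < a) (hb : 0 < b) (t : ℝ) (n : ℕ) :
    taylorCoeff (fun x => phi N a b x t) n =
      (n.factorial : ℝ)⁻¹ * iteratedDeriv n (psi N a b t) 0 := by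
  have h0 : (0 : ℝ) ∈ Ici (0 : ℝ) := mem_Ici.2 le_rfl
  have hc : iteratedDerivWithin n (fun x => phi N a b x t) (Ici 0) 0 =
      iteratedDerivWithin n (psi N a b t) (Ici 0) 0 :=
    iteratedDerivWithin_congr (fun x hx => phi_eq_psi hN ha hb t hx) h0
  rw [taylorCoeff, hc,
    iteratedDerivWithin_eq_iteratedDeriv (uniqueDiffOn_Ici 0)
      ((contDiff_psi hN ha hb t).contDiffAt.of_le (by exact_mod_cast le_top)) h0]
  ring

theorem psi_sub_truncation_isBigO (hN : 2 ≤ N) (ha : 0 < a) (hb : 0 < b) (t : ℝ) (n : ℕ) :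
    (fun x => psi N a b t x -
      ∑ k ∈ Finset.range n, x ^ k * taylorCoeff (fun x => phi N a b x t) k)
      =O[𝓝 0] fun x : ℝ => x ^ n := by
  simpa only [taylorCoeff_phi hN ha hb, smul_eq_mul] using taylor_isBigO (contDiff_psi hN ha hb t) n

/-- The coefficient of `x^(N + 1 + (N - 1) j)` in the Taylor series of `φ(·, t)`. -/
noncomputable def gapCoeff (N : ℕ) (a b t : ℝ) (j : ℕ) : ℝ :=
  -(Complex.I * Complex.exp (Complex.I * t) *
    ∏ i ∈ Finset.range j, -((sigma N a b + i) * Complex.I * (a * ((N : ℝ) - 1) : ℝ))).re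

/-- The expansion of the Laplace integral at zero is evaluated at `z = x^(N-1)` and multiplied by
`x^(N+1)`; hence the gaps. -/
theorem psi_sub_gap_isBigO (hN : 2 ≤ N) (ha : 0 < a) (hb : 0 < b) (t : ℝ) (J : ℕ) :
    (fun x => psi N a b t x -
      ∑ j ∈ Finset.range J, gapCoeff N a b t j * x ^ (N + 1 + (N - 1) * j))
      =O[𝓝 0] fun x : ℝ => x ^ (N + 1 + (N - 1) * J) := by
  have hσ := sigma_nonneg hN ha hb
  have hG := taylor_isBigO (contDiff_infty_laplaceInt (a * ((N : ℝ) - 1)) hσ 0) J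
  have hlim : Tendsto (fun x : ℝ => x ^ (N - 1)) (𝓝 0) (𝓝 0) := by
    have : Tendsto (fun x : ℝ => x ^ (N - 1)) (𝓝 0) (𝓝 (0 ^ (N - 1))) :=
      (continuous_pow (N - 1)).tendsto 0
    rwa [zero_pow (by omega)] at this
  have h1 := hG.comp_tendsto hlim
  have h2 := ((Asymptotics.isBigO_refl (fun x : ℝ => x ^ (N + 1)) (𝓝 0)).mul
    (h1.norm_left))
  refine (Asymptotics.isBigO_of_le _ ?_).trans (h2.congr_right fun x => ?_)
  · intro x
    simp only [Function.comp_apply]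
    set S := ∑ k ∈ Finset.range J, (x ^ (N - 1)) ^ k • ((k.factorial : ℝ)⁻¹ •
      iteratedDeriv k (laplaceInt (a * ((N : ℝ) - 1)) (sigma N a b) 0) 0) with hS
    have e : ∑ j ∈ Finset.range J, gapCoeff N a b t j * x ^ (N + 1 + (N - 1) * j) =
        -x ^ (N + 1) * (Complex.I * Complex.exp (Complex.I * t) * S).re := by
      rw [hS, Finset.mul_sum, Complex.re_sum, Finset.mul_sum]
      refine Finset.sum_congr rfl fun j _ => ?_
      have hf : ((j.factorial : ℝ) : ℂ) ≠ 0 := by exact_mod_cast Nat.factorial_ne_zero j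
      -- The Taylor factor `1/j!` cancels the value `j!` of the Laplace integral at zero. This is
      -- why the coefficients diverge.
      have e1 : ((j.factorial : ℝ)⁻¹ • iteratedDeriv j
          (laplaceInt (a * ((N : ℝ) - 1)) (sigma N a b) 0) 0) =
          ∏ i ∈ Finset.range j, -((sigma N a b + i) * Complex.I * (a * ((N : ℝ) - 1) : ℝ)) := by
        rw [iteratedDeriv_laplaceInt _ _ hσ, laplaceInt_zero, zero_add, Complex.real_smul,
          Complex.ofReal_inv]
        rw [mul_comm, mul_assoc, ← Complex.ofReal_natCast, mul_inv_cancel₀ hf, mul_one]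
      rw [e1, gapCoeff, Complex.real_smul, mul_left_comm, Complex.re_ofReal_mul, pow_add, pow_mul]
      ring
    rw [e, psi, ← mul_sub, ← Complex.sub_re, ← mul_sub, norm_mul, norm_neg, norm_mul (x ^ (N + 1)) (‖_‖)]
    refine mul_le_mul_of_nonneg_left ?_ (norm_nonneg _)
    have h3 : ‖Complex.exp (Complex.I * t)‖ = 1 := by rw [Complex.norm_exp]; simp
    refine (Complex.abs_re_le_norm _).trans ?_
    rw [norm_mul, norm_mul, Complex.norm_I, h3, one_mul, one_mul, norm_norm]
  · rw [Function.comp_apply, ← pow_mul, ← pow_add]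

theorem taylorCoeff_phi_eq (hN : 2 ≤ N) (ha : 0 < a) (hb : 0 < b) (t : ℝ) (n : ℕ) :
    taylorCoeff (fun x => phi N a b x t) n =
      ∑ j ∈ Finset.range (n + 1), if n = N + 1 + (N - 1) * j then gapCoeff N a b t j else 0 := by
  set c := taylorCoeff (fun x => phi N a b x t)
  let P : Polynomial ℝ := ∑ k ∈ Finset.range (n + 1), Polynomial.C (c k) * Polynomial.X ^ k -
    ∑ j ∈ Finset.range (n + 1),
      Polynomial.C (gapCoeff N a b t j) * Polynomial.X ^ (N + 1 + (N - 1) * j)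
  -- Terms with `j > n` have exponents above `n`, so `n + 1` terms suffice. Comparing the two
  -- expansions of `psi` then identifies the coefficients.
  have hn : n + 1 ≤ N + 1 + (N - 1) * (n + 1) := by
    have : 1 * (n + 1) ≤ (N - 1) * (n + 1) := Nat.mul_le_mul_right _ (by omega)
    omega
  have hP : (fun x => P.eval x) =O[𝓝 0] fun x : ℝ => x ^ (n + 1) := by
    refine (((psi_sub_gap_isBigO hN ha hb t (n + 1)).trans (pow_isBigO_pow hn)).sub
      (psi_sub_truncation_isBigO hN ha hb t (n + 1))).congr_left fun x => ?_
    simp only [P, Polynomial.eval_sub, Polynomial.eval_finsetSum, Polynomial.eval_mul,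
      Polynomial.eval_C, Polynomial.eval_pow, Polynomial.eval_X]
    simp only [mul_comm (x ^ _)]
    ring
  have hd := X_pow_dvd_of_isBigO (hP.mono nhdsWithin_le_nhds)
  have h0 := Polynomial.X_pow_dvd_iff.1 hd n (by omega)
  simp only [P, Polynomial.coeff_sub, Polynomial.finsetSum_coeff, Polynomial.coeff_C_mul,
    Polynomial.coeff_X_pow, mul_ite, mul_one, mul_zero, sub_eq_zero] at h0
  rw [← h0]
  simp

theorem prod_neg_mul_I (j : ℕ) :
    (∏ i ∈ Finset.range j, -((sigma N a b + i) * Complex.I * (a * ((N : ℝ) - 1) : ℝ)) : ℂ) =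
      (-Complex.I) ^ j *
        ((∏ i ∈ Finset.range j, (sigma N a b + i) * (a * ((N : ℝ) - 1)) : ℝ) : ℂ) := by
  induction j with
  | zero => simp
  | succ j ih =>
    rw [Finset.prod_range_succ, ih, Finset.prod_range_succ]
    push_cast
    ring

theorem gapCoeff_eq (t : ℝ) (j : ℕ) :
    gapCoeff N a b t j = -(Complex.I * Complex.exp (Complex.I * t) * (-Complex.I) ^ j).re *
      ∏ i ∈ Finset.range j, (sigma N a b + i) * (a * ((N : ℝ) - 1)) := by
  rw [gapCoeff, prod_neg_mul_I, ← mul_assoc, Complex.re_mul_ofReal, neg_mul]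

theorem abs_gapCoeff_le (hN : 2 ≤ N) (ha : 0 < a) (hb : 0 < b) (t : ℝ) (j : ℕ) :
    |gapCoeff N a b t j| ≤ ((sigma N a b + 1) * (a * ((N : ℝ) - 1))) ^ j * j.factorial := by
  have h1 := natCast_sub_one_pos hN
  have hσ := sigma_nonneg hN ha hb
  have hpos : ∀ j : ℕ, 0 ≤ ∏ i ∈ Finset.range j, (sigma N a b + i) * (a * ((N : ℝ) - 1)) :=
    fun j => Finset.prod_nonneg fun i _ => by positivity
  rw [gapCoeff_eq, abs_mul, abs_neg, abs_of_nonneg (hpos j)]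
  have h3 : |(Complex.I * Complex.exp (Complex.I * t) * (-Complex.I) ^ j).re| ≤ 1 := by
    refine (Complex.abs_re_le_norm _).trans ?_
    have h3 : ‖Complex.exp (Complex.I * t)‖ = 1 := by rw [Complex.norm_exp]; simp
    rw [norm_mul, norm_mul, h3, norm_pow, norm_neg, Complex.norm_I]; simp
  refine (mul_le_of_le_one_left (hpos j) h3).trans ?_
  clear h3
  induction j with
  | zero => simp
  | succ j ih =>
    rw [Finset.prod_range_succ, Nat.factorial_succ, pow_succ]
    push_cast
    calc _ ≤ (((sigma N a b + 1) * (a * ((N : ℝ) - 1))) ^ j * j.factorial) *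
          (((sigma N a b + 1) * (j + 1)) * (a * ((N : ℝ) - 1))) := by
          refine mul_le_mul ih ?_ (by positivity) (by positivity)
          refine mul_le_mul_of_nonneg_right ?_ (by positivity)
          -- Uses `σ + j ≤ (σ + 1)(j + 1)`.
          nlinarith [show 0 ≤ sigma N a b * j by positivity]
      _ = _ := by ring

/-- Factor by factor, `σ > 1` gives `σ + i ≥ i + 1`. -/
theorem pow_mul_factorial_le_prod (hN : 2 ≤ N) (ha : 0 < a) (hb : 0 < b) (j : ℕ) :
    (a * ((N : ℝ) - 1)) ^ j * j.factorial ≤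
      ∏ i ∈ Finset.range j, (sigma N a b + i) * (a * ((N : ℝ) - 1)) := by
  have h1 := natCast_sub_one_pos hN
  have hσ := one_lt_sigma hN ha hb
  induction j with
  | zero => simp
  | succ j ih =>
    rw [Finset.prod_range_succ, Nat.factorial_succ, pow_succ]
    push_cast
    calc _ = ((a * ((N : ℝ) - 1)) ^ j * j.factorial) * (((j : ℝ) + 1) * (a * ((N : ℝ) - 1))) := by
          ring
      _ ≤ _ := by
          refine mul_le_mul ih ?_ (by positivity) (Finset.prod_nonneg fun i _ => by positivity)
          exact mul_le_mul_of_nonneg_right (by linarith) (by positivity)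

/-- The real part of `i e^(it) (-i)^j` is `± sin t` for even `j` and `± cos t` for odd `j`. At least
one is nonzero, so one parity class carries a full lower bound. -/
theorem exists_parity_le_abs_gapCoeff (hN : 2 ≤ N) (ha : 0 < a) (hb : 0 < b) (t : ℝ) :
    ∃ (δ : ℝ) (e : ℕ), 0 < δ ∧ ∀ l : ℕ,
      δ * ((a * ((N : ℝ) - 1)) ^ (2 * l + e) * (2 * l + e).factorial) ≤
        |gapCoeff N a b t (2 * l + e)| := by
  have hexp : Complex.exp (Complex.I * t) = Real.cos t + Real.sin t * Complex.I := by
    rw [mul_comm, Complex.exp_mul_I]; push_cast; ring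
  have hsq : (-Complex.I) ^ 2 = -1 := by rw [neg_sq, Complex.I_sq]
  have main : ∀ (δ : ℝ) (e : ℕ),
      |(Complex.I * Complex.exp (Complex.I * t) * (-Complex.I) ^ e).re| = δ → ∀ l : ℕ,
      δ * ((a * ((N : ℝ) - 1)) ^ (2 * l + e) * (2 * l + e).factorial) ≤
        |gapCoeff N a b t (2 * l + e)| := by
    intro δ e hδ l
    rw [gapCoeff_eq, abs_mul, abs_neg]
    have : (Complex.I * Complex.exp (Complex.I * t) * (-Complex.I) ^ (2 * l + e)) =
        ((-1 : ℝ) ^ l : ℝ) * (Complex.I * Complex.exp (Complex.I * t) * (-Complex.I) ^ e) := by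
      rw [pow_add, pow_mul, hsq]; push_cast; ring
    rw [this, Complex.re_ofReal_mul, abs_mul, abs_pow, abs_neg, abs_one, one_pow, one_mul, hδ]
    refine mul_le_mul_of_nonneg_left ?_ (hδ ▸ abs_nonneg _)
    exact (pow_mul_factorial_le_prod hN ha hb _).trans (le_abs_self _)
  by_cases hc : Real.cos t = 0
  · have hs : Real.sin t ≠ 0 := by
      intro hs
      have := Real.sin_sq_add_cos_sq t
      rw [hs, hc] at this
      norm_num at this
    refine ⟨|Real.sin t|, 0, abs_pos.2 hs, main _ 0 ?_⟩
    rw [hexp, pow_zero, mul_one, ← abs_neg (Real.sin t)]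
    congr 1
    simp [Complex.sin_ofReal_re]
  · refine ⟨|Real.cos t|, 1, abs_pos.2 hc, main _ 1 ?_⟩
    rw [hexp]
    congr 1
    simp [Complex.cos_ofReal_re]

theorem taylorCoeff_phi_gap (hN : 2 ≤ N) (ha : 0 < a) (hb : 0 < b) (t : ℝ) (j : ℕ) :
    taylorCoeff (fun x => phi N a b x t) (N + 1 + (N - 1) * j) = gapCoeff N a b t j := by
  rw [taylorCoeff_phi_eq hN ha hb, Finset.sum_eq_single j]
  · simp
  · intro i _ hij
    rw [if_neg]
    intro h
    exact hij (Nat.eq_of_mul_eq_mul_left (show 0 < N - 1 by omega) (by omega))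
  · intro h
    exfalso
    refine h (Finset.mem_range.2 ?_)
    have : 1 * j ≤ (N - 1) * j := Nat.mul_le_mul_right _ (by omega)
    omega

theorem taylorCoeff_phi_of_ne (hN : 2 ≤ N) (ha : 0 < a) (hb : 0 < b) (t : ℝ) {n : ℕ}
    (h : ∀ j, n ≠ N + 1 + (N - 1) * j) : taylorCoeff (fun x => phi N a b x t) n = 0 := by
  rw [taylorCoeff_phi_eq hN ha hb]
  exact Finset.sum_eq_zero fun j _ => if_neg (h j)

/-- The Taylor coefficients of `φ` satisfy Gevrey bounds of order `1/(N-1)`. -/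
theorem exists_abs_taylorCoeff_phi_le (hN : 2 ≤ N) (ha : 0 < a) (hb : 0 < b) :
    ∃ c₁ c₂ : ℝ, 0 < c₁ ∧ 0 < c₂ ∧ ∀ (t : ℝ) (n : ℕ),
      |taylorCoeff (fun x => phi N a b x t) n|
        ≤ c₁ * c₂ ^ n * (n.factorial : ℝ) ^ (1 / ((N : ℝ) - 1)) := by
  have h1 := natCast_sub_one_pos hN
  have hσ := sigma_nonneg hN ha hb
  set B := (sigma N a b + 1) * (a * ((N : ℝ) - 1))
  have hB : 0 ≤ B := by positivity
  refine ⟨1, max 1 B, one_pos, by positivity, fun t n => ?_⟩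
  by_cases h : ∃ j, n = N + 1 + (N - 1) * j
  · obtain ⟨j, rfl⟩ := h
    rw [taylorCoeff_phi_gap hN ha hb, one_mul]
    refine (abs_gapCoeff_le hN ha hb t j).trans (mul_le_mul ?_ ?_ (by positivity) (by positivity))
    · have hj : 1 * j ≤ (N - 1) * j := Nat.mul_le_mul_right _ (by omega)
      exact (pow_le_pow_left₀ hB (le_max_right _ _) j).trans
        (pow_le_pow_right₀ (le_max_left _ _) (by omega))
    · have hf : ((j.factorial : ℝ)) ^ (N - 1) ≤ ((N + 1 + (N - 1) * j).factorial : ℝ) := by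
        exact_mod_cast (factorial_pow_le_factorial_mul (N - 1) j).trans
          (Nat.factorial_le (by omega))
      have := Real.rpow_le_rpow (by positivity) hf (show 0 ≤ 1 / ((N : ℝ) - 1) by positivity)
      rwa [← Real.rpow_natCast, ← Real.rpow_mul (by positivity), Nat.cast_pred (by omega),
        mul_one_div_cancel h1.ne', Real.rpow_one] at this
  · rw [taylorCoeff_phi_of_ne hN ha hb t (fun j hj => h ⟨j, hj⟩), abs_zero]
    positivity

/-- The Taylor series of `φ(·, t)` is not Gevrey of any order less than `1/(N-1)`. -/
theorem not_isGevrey_taylorCoeff_phi (hN : 2 ≤ N) (ha : 0 < a) (hb : 0 < b) (t : ℝ) {s : ℝ}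
    (hs : 0 ≤ s) (hs' : s < 1 / ((N : ℝ) - 1)) :
    ¬ IsGevrey s (taylorCoeff (fun x => phi N a b x t)) := by
  rintro ⟨c₁, c₂, hc₁, hc₂, hbound⟩
  have h1 := natCast_sub_one_pos hN
  obtain ⟨δ, e, hδ, hlow⟩ := exists_parity_le_abs_gapCoeff hN ha hb t
  set m := N - 1 with hm
  have hmc : (m : ℝ) = (N : ℝ) - 1 := by rw [hm, Nat.cast_pred (by omega)]
  have hm1 : 1 ≤ m := by omega
  have hm1' : (1 : ℝ) ≤ m := by exact_mod_cast hm1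
  rw [← hmc] at h1 hs' hlow
  -- With `m = N - 1`, the Gevrey bound of order `s` at index `n` is of size `(j!)^θ` up to
  -- geometric factors, with `θ < 1`, while the coefficient is at least of size `j!`.
  set θ := (m : ℝ) * s with hθ
  have hθ0 : 0 ≤ θ := by positivity
  have hθ1 : θ < 1 := by rw [hθ, mul_comm]; exact (lt_div_iff₀ h1).1 hs'
  set C₂ := max 1 c₂
  have hC₂ : 1 ≤ C₂ := le_max_left _ _
  -- a bound `j!^(1 - θ) ≤ A D^j` along the parity class
  obtain ⟨A, D, hA, hD, hAD⟩ : ∃ A D : ℝ, 0 < A ∧ 0 < D ∧ ∀ l : ℕ,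
      ((2 * l + e).factorial : ℝ) ^ (1 - θ) ≤ A * D ^ (2 * l + e) := by
    refine ⟨c₁ * C₂ ^ (m * 3) * ((m : ℝ) ^ θ) ^ 3 * 48 / δ, C₂ ^ m * (m : ℝ) ^ θ * 2 / (a * m),
      by positivity, by positivity, fun l => ?_⟩
    set j := 2 * l + e
    have hj : N + 1 + m * j ≤ m * (j + 3) := by
      have h0 : N + 1 ≤ m * 3 := by omega
      rw [mul_add m j 3, add_comm]
      exact Nat.add_le_add_left h0 _
    have hb1 := (hlow l).trans ((taylorCoeff_phi_gap hN ha hb t j) ▸ hbound (N + 1 + m * j))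
    have hb2 : c₂ ^ (N + 1 + m * j) ≤ C₂ ^ (m * (j + 3)) :=
      (pow_le_pow_left₀ hc₂.le (le_max_right _ _) _).trans (pow_le_pow_right₀ hC₂ hj)
    have hb3 : ((N + 1 + m * j).factorial : ℝ) ^ s ≤
        ((m : ℝ) ^ θ) ^ (j + 3) * (48 * 2 ^ j) * (j.factorial : ℝ) ^ θ := by
      have h3 : ((N + 1 + m * j).factorial : ℝ) ≤ ((m : ℝ) ^ (j + 3) * (j + 3).factorial) ^ m := by
        rw [mul_pow, ← pow_mul, mul_comm (j + 3) m]
        exact_mod_cast (Nat.factorial_le hj).trans (factorial_mul_le_pow_mul m (j + 3))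
      have h4 : (((j + 3).factorial : ℕ) : ℝ) ≤ 48 * 2 ^ j * j.factorial := by
        exact_mod_cast factorial_add_three_le j
      have h5 : (1 : ℝ) ≤ 48 * 2 ^ j := by
        have : (1 : ℝ) ≤ 2 ^ j := one_le_pow₀ (by norm_num)
        linarith
      calc ((N + 1 + m * j).factorial : ℝ) ^ s
          ≤ (((m : ℝ) ^ (j + 3) * (j + 3).factorial) ^ m) ^ s :=
            Real.rpow_le_rpow (by positivity) h3 hs
        _ = ((m : ℝ) ^ θ) ^ (j + 3) * ((j + 3).factorial : ℝ) ^ θ := by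
            rw [← Real.rpow_natCast _ m, ← Real.rpow_mul (by positivity), ← hθ,
              Real.mul_rpow (by positivity) (by positivity), ← Real.rpow_natCast _ (j + 3),
              ← Real.rpow_natCast _ (j + 3), ← Real.rpow_mul (by positivity),
              ← Real.rpow_mul (by positivity), mul_comm θ]
        _ ≤ ((m : ℝ) ^ θ) ^ (j + 3) * ((48 * 2 ^ j) * (j.factorial : ℝ) ^ θ) := by
            refine mul_le_mul_of_nonneg_left ?_ (by positivity)
            refine (Real.rpow_le_rpow (by positivity) h4 hθ0).trans ?_
            rw [Real.mul_rpow (by positivity) (by positivity)]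
            refine mul_le_mul_of_nonneg_right ?_ (by positivity)
            exact (Real.rpow_le_rpow_of_exponent_le h5 hθ1.le).trans_eq (Real.rpow_one _)
        _ = _ := by ring
    have hjpos : (0 : ℝ) < (j.factorial : ℝ) := by exact_mod_cast Nat.factorial_pos j
    have hb4 : δ * ((a * m) ^ j * j.factorial) ≤ c₁ * C₂ ^ (m * (j + 3)) *
        (((m : ℝ) ^ θ) ^ (j + 3) * (48 * 2 ^ j) * (j.factorial : ℝ) ^ θ) :=
      hb1.trans (mul_le_mul (mul_le_mul_of_nonneg_left hb2 hc₁.le) hb3 (by positivity)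
        (by positivity))
    rw [Real.rpow_sub hjpos, Real.rpow_one, div_le_iff₀ (by positivity), div_pow, div_mul_div_comm,
      div_mul_eq_mul_div, le_div_iff₀ (by positivity)]
    calc (j.factorial : ℝ) * (δ * (a * m) ^ j) = δ * ((a * m) ^ j * j.factorial) := by ring
      _ ≤ _ := hb4
      _ = _ := by
        rw [mul_add m, pow_add, pow_add, mul_pow, mul_pow, pow_mul C₂ m j]
        ring
  have hexp : 0 < 1 - θ := by linarith
  -- The power `1/(1-θ)` of the previous bound would dominate `j!` by a geometric sequence, against
  -- `D^j / j! → 0`.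
  have hfin : ∀ l : ℕ, 1 ≤ A ^ (1 / (1 - θ)) *
      ((D ^ (1 / (1 - θ))) ^ (2 * l + e) / ((2 * l + e).factorial : ℝ)) := by
    intro l
    have := Real.rpow_le_rpow (by positivity) (hAD l) (show 0 ≤ 1 / (1 - θ) by positivity)
    rw [← Real.rpow_mul (by positivity), mul_one_div_cancel hexp.ne', Real.rpow_one,
      Real.mul_rpow hA.le (by positivity)] at this
    have hjpos : (0 : ℝ) < ((2 * l + e).factorial : ℝ) := by exact_mod_cast Nat.factorial_pos _
    rw [mul_div_assoc', le_div_iff₀ hjpos, one_mul]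
    refine this.trans_eq ?_
    congr 1
    rw [← Real.rpow_natCast, ← Real.rpow_natCast, ← Real.rpow_mul hD.le, ← Real.rpow_mul hD.le,
      mul_comm]
  have hlim : Tendsto (fun l : ℕ => A ^ (1 / (1 - θ)) *
      ((D ^ (1 / (1 - θ))) ^ (2 * l + e) / ((2 * l + e).factorial : ℝ))) atTop (𝓝 0) := by
    have h2l : Tendsto (fun l : ℕ => 2 * l + e) atTop atTop :=
      tendsto_atTop_mono (fun l => by simp only [id]; omega) tendsto_id
    simpa using ((FloorSemiring.tendsto_pow_div_factorial_atTop
      (D ^ (1 / (1 - θ)))).comp h2l).const_mul (A ^ (1 / (1 - θ)))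
  have := ge_of_tendsto' hlim hfin
  linarith

end params

/-! ### Analyticity and normal form of the Poincaré map -/

theorem exists_expansion_of_analyticAt {f : ℝ → ℝ} (hf : AnalyticAt ℝ f 0) :
    ∃ c : ℕ → ℝ, c 0 = f 0 ∧ c 1 = deriv f 0 ∧ ∀ n : ℕ,
      (fun x => f x - ∑ k ∈ Finset.range n, x ^ k * c k) =O[𝓝 0] fun x : ℝ => x ^ n := by
  obtain ⟨p, hp⟩ := hf
  refine ⟨p.coeff, ?_, ?_, fun n => ?_⟩
  · exact hp.coeff_zero 1
  · rw [hp.deriv]; rfl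
  · have h := (hp.isBigO_sub_partialSum_pow n)
    simp only [zero_add, FormalMultilinearSeries.partialSum,
      FormalMultilinearSeries.apply_eq_pow_smul_coeff, smul_eq_mul, ← norm_pow] at h
    exact h.of_norm_right

theorem analyticAt_one_add_rpow (r : ℝ) : AnalyticAt ℝ (fun v : ℝ => (1 + v) ^ r) 0 := by
  have h1 : AnalyticAt ℝ (fun x : ℝ => x ^ r) (1 + 0) :=
    (Real.contDiffAt_rpow_const_of_ne (by norm_num)).analyticAt
  exact h1.comp (f := fun v : ℝ => 1 + v) (analyticAt_const.add analyticAt_id)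

theorem hasDerivAt_one_add_rpow (r : ℝ) : HasDerivAt (fun v : ℝ => (1 + v) ^ r) r 0 := by
  have := ((hasDerivAt_id (0 : ℝ)).const_add 1).rpow_const (p := r) (Or.inl (by simp))
  simpa using this

theorem one_add_rpow_sub_isBigO (r : ℝ) :
    (fun v : ℝ => (1 + v) ^ r - 1 - r * v) =O[𝓝 0] fun v : ℝ => v ^ 2 := by
  obtain ⟨c, h0, h1, h⟩ := exists_expansion_of_analyticAt (analyticAt_one_add_rpow r)
  rw [(hasDerivAt_one_add_rpow r).deriv] at h1
  refine (h 2).congr_left fun v => ?_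
  simp [Finset.sum_range_succ, h0, h1]
  ring

section params

variable {N : ℕ} {a b : ℝ}

/-- The radius `1/(2cT)` keeps `|c τ z| ≤ 1/2` for `τ ≤ T`. The base then stays in the slit plane
with modulus at least `1/2`, which bounds the integrand and its derivative in `z`. The radius
shrinks to zero as `T → ∞`. -/
theorem differentiableAt_integral_cos_mul_cpow {c T r : ℝ} (hc : 0 < c) (hT : 0 < T) (hr : 0 ≤ r)
    (t : ℝ) {z : ℂ} (hz : ‖z‖ < 1 / (2 * c * T)) :
    DifferentiableAt ℂ (fun z : ℂ => ∫ τ in (0 : ℝ)..T,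
      (Real.cos (t + τ) : ℂ) * (1 + c * τ * z) ^ ((-r : ℝ) : ℂ)) z := by
  have hsmall : ∀ τ ∈ uIoc 0 T, ∀ z ∈ Metric.ball (0 : ℂ) (1 / (2 * c * T)),
      ‖(c * τ * z : ℂ)‖ ≤ 1 / 2 := by
    intro τ hτ z hz
    rw [uIoc_of_le hT.le] at hτ
    rw [mem_ball_zero_iff, lt_div_iff₀ (by positivity)] at hz
    rw [norm_mul, norm_mul, Complex.norm_real, Complex.norm_real, Real.norm_of_nonneg hc.le,
      Real.norm_of_nonneg hτ.1.le]
    have : c * τ * ‖z‖ ≤ c * T * ‖z‖ := by gcongr; exact hτ.2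
    linarith
  have hslit : ∀ τ ∈ uIoc 0 T, ∀ z ∈ Metric.ball (0 : ℂ) (1 / (2 * c * T)),
      (1 + c * τ * z : ℂ) ∈ Complex.slitPlane := fun τ hτ z hz =>
    Complex.mem_slitPlane_of_norm_lt_one ((hsmall τ hτ z hz).trans_lt (by norm_num))
  have hball : Metric.ball (0 : ℂ) (1 / (2 * c * T)) ∈ 𝓝 z :=
    Metric.isOpen_ball.mem_nhds (by simpa using hz)
  have hz' : z ∈ Metric.ball (0 : ℂ) (1 / (2 * c * T)) := mem_of_mem_nhds hball
  have hmeas : ∀ (r : ℝ), ∀ z ∈ Metric.ball (0 : ℂ) (1 / (2 * c * T)), ContinuousOn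
      (fun τ : ℝ => (Real.cos (t + τ) : ℂ) * (1 + c * τ * z) ^ ((-r : ℝ) : ℂ)) (uIoc 0 T) := by
    intro r z hz
    refine ContinuousOn.mul (by fun_prop) (ContinuousOn.cpow (by fun_prop) continuousOn_const ?_)
    exact fun τ hτ => hslit τ hτ z hz
  have hcos : ∀ τ : ℝ, ‖(Real.cos (t + τ) : ℂ)‖ ≤ 1 := fun τ => by
    rw [Complex.norm_real]; exact Real.abs_cos_le_one _
  have hpow : ∀ {r : ℝ}, 0 ≤ r → ∀ τ ∈ uIoc 0 T, ∀ z ∈ Metric.ball (0 : ℂ) (1 / (2 * c * T)),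
      ‖(1 + c * τ * z : ℂ) ^ ((-r : ℝ) : ℂ)‖ ≤ (1 / 2) ^ (-r) := by
    intro r hr τ hτ z hz
    rw [Complex.norm_cpow_real]
    refine Real.rpow_le_rpow_of_nonpos (by norm_num) ?_ (by linarith)
    have h1 := norm_sub_norm_le (1 : ℂ) (-(c * τ * z))
    rw [norm_one, norm_neg, sub_neg_eq_add] at h1
    linarith [hsmall τ hτ z hz]
  have key := intervalIntegral.hasDerivAt_integral_of_dominated_loc_of_deriv_le (𝕜 := ℂ)
    (μ := volume) (a := 0) (b := T) (x₀ := z) (s := Metric.ball (0 : ℂ) (1 / (2 * c * T)))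
    (F := fun z τ => (Real.cos (t + τ) : ℂ) * (1 + c * τ * z) ^ ((-r : ℝ) : ℂ))
    (F' := fun z τ => (-(r * (c * τ)) : ℂ) *
      ((Real.cos (t + τ) : ℂ) * (1 + c * τ * z) ^ ((-(r + 1) : ℝ) : ℂ)))
    (bound := fun _ => r * (c * T) * (1 / 2) ^ (-(r + 1))) hball ?_ ?_ ?_ ?_ ?_ ?_
  · exact key.2.differentiableAt
  · filter_upwards [hball] with w hw
    exact (hmeas r w hw).aestronglyMeasurable measurableSet_uIoc
  · rw [intervalIntegrable_iff]
    have : IsFiniteMeasure (volume.restrict (uIoc 0 T)) := by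
      rw [uIoc_of_le hT.le]; infer_instance
    refine Integrable.of_bound ((hmeas r z hz').aestronglyMeasurable measurableSet_uIoc)
      ((1 / 2) ^ (-r)) ?_
    refine (ae_restrict_iff' measurableSet_uIoc).2 (Eventually.of_forall fun τ hτ => ?_)
    rw [norm_mul]
    exact (mul_le_of_le_one_left (norm_nonneg _) (hcos τ)).trans (hpow hr τ hτ z hz')
  · exact (ContinuousOn.mul (by fun_prop) (hmeas (r + 1) z hz')).aestronglyMeasurable
      measurableSet_uIoc
  · refine Eventually.of_forall fun τ hτ w hw => ?_
    rw [norm_mul, norm_mul]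
    have h1 : ‖(-(r * (c * τ)) : ℂ)‖ ≤ r * (c * T) := by
      have hτ' := hτ
      rw [uIoc_of_le hT.le] at hτ'
      rw [norm_neg, norm_mul, norm_mul, Complex.norm_real, Complex.norm_real, Complex.norm_real,
        Real.norm_of_nonneg hc.le, Real.norm_of_nonneg hτ'.1.le, Real.norm_of_nonneg hr]
      gcongr
      exact hτ'.2
    exact mul_le_mul h1 ((mul_le_of_le_one_left (norm_nonneg _) (hcos τ)).trans
      (hpow (by linarith) τ hτ w hw)) (by positivity) (by positivity)
  · exact intervalIntegrable_const
  · refine Eventually.of_forall fun τ hτ w hw => ?_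
    have h1 : HasDerivAt (fun z : ℂ => 1 + c * τ * z) (c * τ : ℂ) w := by
      simpa using ((hasDerivAt_id w).const_mul (c * τ : ℂ)).const_add 1
    have h2 := (h1.cpow_const (c := ((-r : ℝ) : ℂ)) (hslit τ hτ w hw)).const_mul
      (Real.cos (t + τ) : ℂ)
    convert! h2 using 1
    have : ((-(r + 1) : ℝ) : ℂ) = ((-r : ℝ) : ℂ) - 1 := by push_cast; ring
    rw [this]
    push_cast
    ring

/-- The integral `∫_0^T cos (t + τ) (1 + c τ z)^{-r} dτ` is real analytic in `z` near `0`, and it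
is an increment of `tailIntegral`. -/
theorem exists_analyticAt_eq_tailIntegral_sub {c T r : ℝ} (hc : 0 < c) (hT : 0 < T) (hr : 0 ≤ r)
    (t : ℝ) : ∃ J : ℝ → ℝ, AnalyticAt ℝ J 0 ∧ ∀ᶠ z in 𝓝 0,
      (tailIntegral c r z t 0).re - (tailIntegral c r z t T).re = J z := by
  set Jc : ℂ → ℂ := fun z => ∫ τ in (0 : ℝ)..T,
      (Real.cos (t + τ) : ℂ) * (1 + c * τ * z) ^ ((-r : ℝ) : ℂ) with hJc
  have hpos : 0 < 1 / (2 * c * T) := by positivity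
  have hA : AnalyticAt ℂ Jc 0 := by
    refine DifferentiableOn.analyticAt (s := Metric.ball (0 : ℂ) (1 / (2 * c * T))) ?_
      (Metric.ball_mem_nhds 0 hpos)
    intro z hz
    exact (differentiableAt_integral_cos_mul_cpow hc hT hr t
      (by simpa using hz)).differentiableWithinAt
  refine ⟨fun z => (Jc z).re, ?_, ?_⟩
  · have h1 : AnalyticAt ℝ Jc ((0 : ℝ) : ℂ) := by
      rw [Complex.ofReal_zero]; exact hA.restrictScalars
    have h2 : AnalyticAt ℝ (fun z : ℝ => Jc z) 0 :=
      h1.comp (Complex.ofRealCLM.analyticAt 0)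
    exact (Complex.reCLM.analyticAt _).comp h2
  · filter_upwards [Metric.ball_mem_nhds (0 : ℝ) hpos] with z hz
    rw [mem_ball_zero_iff, lt_div_iff₀ (by positivity), Real.norm_eq_abs] at hz
    have hu : ∀ τ ∈ uIcc 0 T, 0 < 1 + c * τ * z := by
      intro τ hτ
      rw [uIcc_of_le hT.le] at hτ
      have h1 : |c * τ * z| ≤ c * T * |z| := by
        rw [abs_mul, abs_of_nonneg (mul_nonneg hc.le hτ.1)]
        gcongr
        exact hτ.2
      have h2 := neg_abs_le (c * τ * z)
      linarith
    have hcont : ContinuousOn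
        (fun τ : ℝ => -(Real.cos (t + τ) * (1 + c * τ * z) ^ (-r))) (uIcc 0 T) := by
      refine (ContinuousOn.mul (by fun_prop) (ContinuousOn.rpow_const (by fun_prop) ?_)).neg
      exact fun τ hτ => Or.inl (hu τ hτ).ne'
    have hftc := intervalIntegral.integral_eq_sub_of_hasDerivAt
      (fun τ hτ => hasDerivAt_tailIntegral_re hr c z t τ (hu τ hτ)) hcont.intervalIntegrable
    have hre : Jc z =
        ((∫ τ in (0 : ℝ)..T, Real.cos (t + τ) * (1 + c * τ * z) ^ (-r) : ℝ) : ℂ) := by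
      rw [hJc, ← intervalIntegral.integral_ofReal]
      refine intervalIntegral.integral_congr fun τ hτ => ?_
      rw [Complex.ofReal_mul, Complex.ofReal_cpow (hu τ hτ).le]
      push_cast
      rfl
    rw [hre, Complex.ofReal_re]
    rw [intervalIntegral.integral_neg] at hftc
    linarith

theorem eventually_dil_pos (hN : 2 ≤ N) (a T : ℝ) : ∀ᶠ x in 𝓝 (0 : ℝ), 0 < dil N a T x := by
  have hc : ContinuousAt (fun x => dil N a T x) 0 := by unfold dil; fun_prop
  refine hc.eventually (lt_mem_nhds ?_)
  simp [dil, zero_pow (show N - 1 ≠ 0 by omega)]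

theorem eventually_stroboscopicMap_eq (hN : 2 ≤ N) (ha : 0 < a) (hb : 0 < b) (t₀ : ℝ) {T : ℝ}
    (hT : 0 ≤ T) : ∀ᶠ p in 𝓝 (0 : ℝ × ℝ),
      stroboscopicMap (field N a b) t₀ T p = (flowX N a T p.1, flowY N a b t₀ T p) :=
  ((continuous_fst.tendsto (0 : ℝ × ℝ)).eventually (eventually_dil_pos hN a T)).mono
    fun _ hp => stroboscopicMap_eq_flow hN ha hb t₀ hT hp

theorem tendsto_mul_pow_zero {m : ℕ} (hm : m ≠ 0) (κ : ℝ) :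
    Tendsto (fun x : ℝ => κ * x ^ m) (𝓝 0) (𝓝 0) := by
  have h : Continuous fun x : ℝ => κ * x ^ m := by fun_prop
  simpa [zero_pow hm] using h.tendsto 0

theorem analyticAt_dil_rpow (hN : 2 ≤ N) (a T r : ℝ) :
    AnalyticAt ℝ (fun x => dil N a T x ^ r) 0 := by
  have h := analyticAt_one_add_rpow r
  have h0 : a * ((N : ℝ) - 1) * T * (0 : ℝ) ^ (N - 1) = 0 := by
    rw [zero_pow (by omega), mul_zero]
  rw [← h0] at h
  exact h.comp (f := fun x : ℝ => a * ((N : ℝ) - 1) * T * x ^ (N - 1))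
    (analyticAt_const.mul (analyticAt_id.pow _))

theorem analyticAt_flowX (hN : 2 ≤ N) (a T : ℝ) : AnalyticAt ℝ (flowX N a T) 0 :=
  analyticAt_id.mul (analyticAt_dil_rpow hN a T _)

theorem dil_rpow_sub_isBigO (hN : 2 ≤ N) (a T r : ℝ) :
    (fun x => dil N a T x ^ r - 1 - r * (a * ((N : ℝ) - 1) * T * x ^ (N - 1)))
      =O[𝓝 0] fun x : ℝ => x ^ (2 * (N - 1)) := by
  have h := (one_add_rpow_sub_isBigO r).comp_tendsto
    (tendsto_mul_pow_zero (show N - 1 ≠ 0 by omega) (a * ((N : ℝ) - 1) * T))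
  refine h.trans ?_
  have h2 := (Asymptotics.isBigO_refl (fun x : ℝ => x ^ (2 * (N - 1))) (𝓝 0)).const_mul_left
    ((a * ((N : ℝ) - 1) * T) ^ 2)
  refine h2.congr_left fun x => ?_
  simp only [Function.comp_apply]
  rw [mul_pow _ (x ^ (N - 1)), ← pow_mul, mul_comm 2]

theorem fst_isBigO_norm : (fun p : ℝ × ℝ => p.1) =O[𝓝 0] fun p : ℝ × ℝ => ‖p‖ :=
  Asymptotics.isBigO_of_le _ fun p => by rw [norm_norm]; exact norm_fst_le p

theorem snd_isBigO_norm : (fun p : ℝ × ℝ => p.2) =O[𝓝 0] fun p : ℝ × ℝ => ‖p‖ :=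
  Asymptotics.isBigO_of_le _ fun p => by rw [norm_norm]; exact norm_snd_le p

theorem norm_pow_isBigO_norm_pow {m n : ℕ} (h : m ≤ n) :
    (fun p : ℝ × ℝ => ‖p‖ ^ n) =O[𝓝 0] fun p : ℝ × ℝ => ‖p‖ ^ m := by
  have : Tendsto (fun p : ℝ × ℝ => ‖p‖) (𝓝 0) (𝓝 0) := by
    simpa using (continuous_norm (E := ℝ × ℝ)).tendsto 0
  exact (pow_isBigO_pow h).comp_tendsto this

theorem tendsto_fst_zero : Tendsto (fun p : ℝ × ℝ => p.1) (𝓝 0) (𝓝 0) :=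
  continuous_fst.tendsto (0 : ℝ × ℝ)

theorem hasParabolicForm_stroboscopicMap (hN : 2 ≤ N) (ha : 0 < a) (hb : 0 < b) (t₀ : ℝ) {T : ℝ}
    (hT : 0 < T) :
    HasParabolicForm N N (T * a) (T * b) (stroboscopicMap (field N a b) t₀ T) := by
  have h1 := natCast_sub_one_pos hN
  obtain ⟨J, hJ, hJe⟩ := exists_analyticAt_eq_tailIntegral_sub (c := a * ((N : ℝ) - 1))
    (by positivity) hT (sigma_nonneg hN ha hb) t₀
  set β := b / (a * ((N : ℝ) - 1)) with hβ
  have hfst : AnalyticAt ℝ (fun p : ℝ × ℝ => p.1) 0 := analyticAt_fst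
  have hsnd : AnalyticAt ℝ (fun p : ℝ × ℝ => p.2) 0 := analyticAt_snd
  have hpow0 : (0 : ℝ) ^ (N - 1) = 0 := zero_pow (by omega)
  have hJN : AnalyticAt ℝ (fun x : ℝ => J (x ^ (N - 1))) 0 := by
    rw [← hpow0] at hJ
    exact hJ.comp (f := fun x : ℝ => x ^ (N - 1)) (analyticAt_id.pow _)
  have hW : AnalyticAt ℝ (fun x : ℝ => dil N a T x ^ β * J (x ^ (N - 1))) 0 :=
    (analyticAt_dil_rpow hN a T β).mul hJN
  -- No homogeneous correction of degree `N` is needed. The dilation powers are affine in `x^(N-1)`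
  -- up to `O(x^(2N-2))`, and `2N - 1 ≥ N + 1` because `N ≥ 2`.
  refine ⟨0, 0, fun p => flowX N a T p.1 - p.1 + T * a * p.1 ^ N,
    fun p => (dil N a T p.1 ^ β - 1 - β * (a * ((N : ℝ) - 1) * T * p.1 ^ (N - 1))) * p.2 +
      p.1 ^ (N + 1) * (dil N a T p.1 ^ β * J (p.1 ^ (N - 1))),
    MvPolynomial.isHomogeneous_zero _ _ _, MvPolynomial.isHomogeneous_zero _ _ _,
    by simp, by simp, by simp, ?_, ?_, ?_, ?_, ?_⟩
  · have hX : AnalyticAt ℝ (fun p : ℝ × ℝ => flowX N a T p.1) 0 :=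
      (analyticAt_flowX hN a T).comp (f := fun p : ℝ × ℝ => p.1) (x := (0 : ℝ × ℝ)) hfst
    exact (hX.sub hfst).add (analyticAt_const.mul (hfst.pow N))
  · have hD : AnalyticAt ℝ (fun p : ℝ × ℝ => dil N a T p.1 ^ β) 0 :=
      (analyticAt_dil_rpow hN a T β).comp (f := fun p : ℝ × ℝ => p.1) (x := (0 : ℝ × ℝ)) hfst
    have hW' : AnalyticAt ℝ (fun p : ℝ × ℝ => dil N a T p.1 ^ β * J (p.1 ^ (N - 1))) 0 :=
      hW.comp (f := fun p : ℝ × ℝ => p.1) (x := (0 : ℝ × ℝ)) hfst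
    exact (((hD.sub analyticAt_const).sub (analyticAt_const.mul
      (analyticAt_const.mul (hfst.pow _)))).mul hsnd).add ((hfst.pow _).mul hW')
  · have h := ((Asymptotics.isBigO_refl (fun x : ℝ => x) (𝓝 0)).mul
      (dil_rpow_sub_isBigO hN a T (-(1 / ((N : ℝ) - 1))))).comp_tendsto tendsto_fst_zero
    have h2 : (fun p : ℝ × ℝ => p.1 * p.1 ^ (2 * (N - 1))) =O[𝓝 0]
        fun p : ℝ × ℝ => ‖p‖ ^ (N + 1) := by
      refine ((fst_isBigO_norm.mul (fst_isBigO_norm.pow (2 * (N - 1)))).congr_right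
        fun p => (pow_succ' ‖p‖ _).symm).trans (norm_pow_isBigO_norm_pow (by omega))
    refine (h.trans h2).congr_left fun p => ?_
    simp only [Function.comp_apply, flowX]
    have e : p.1 ^ N = p.1 ^ (N - 1) * p.1 := by rw [← pow_succ]; congr 1; omega
    rw [e]
    field_simp
    ring
  · refine Asymptotics.IsBigO.add ?_ ?_
    · have h := ((dil_rpow_sub_isBigO hN a T β).comp_tendsto tendsto_fst_zero).mul snd_isBigO_norm
      refine h.trans ?_
      refine (((fst_isBigO_norm.pow (2 * (N - 1))).mul
        (Asymptotics.isBigO_refl _ _)).congr_right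
        fun p => (pow_succ ‖p‖ _).symm).trans (norm_pow_isBigO_norm_pow (by omega))
    · have h := (fst_isBigO_norm.pow (N + 1)).mul
        ((hW.continuousAt.tendsto.comp tendsto_fst_zero).isBigO_one ℝ)
      simpa using h
  · have hz : Tendsto (fun p : ℝ × ℝ => p.1 ^ (N - 1)) (𝓝 0) (𝓝 0) := by
      simpa [Function.comp_def] using
        (tendsto_mul_pow_zero (show N - 1 ≠ 0 by omega) 1).comp tendsto_fst_zero
    filter_upwards [eventually_stroboscopicMap_eq hN ha hb t₀ hT.le, hz.eventually hJe,
      tendsto_fst_zero.eventually (eventually_dil_pos hN a T)] with p hp hpJ hpd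
    rw [hp, flowY_eq hN ha.ne' hpd, hpJ]
    simp only [map_zero, add_zero]
    refine Prod.ext (by simp only; ring) ?_
    have e : β * (a * ((N : ℝ) - 1) * T * p.1 ^ (N - 1)) = T * b * p.1 ^ (N - 1) := by
      rw [hβ]; field_simp
    simp only [e]
    ring

end params

/-! ### Formal invariance of the graph -/

section params

variable {N : ℕ} {a b : ℝ}

/-- By periodicity the same `psi` occurs before and after the map, so the vertical offset `y - ψ` is
simply multiplied by a power of the dilation. -/
theorem eventually_stroboscopicMap_two_pi_eq (hN : 2 ≤ N) (ha : 0 < a) (hb : 0 < b) (t₀ : ℝ) :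
    ∀ᶠ p in 𝓝 (0 : ℝ × ℝ), stroboscopicMap (field N a b) t₀ (2 * Real.pi) p =
      (flowX N a (2 * Real.pi) p.1,
        dil N a (2 * Real.pi) p.1 ^ (b / (a * ((N : ℝ) - 1))) * (p.2 - psi N a b t₀ p.1) +
          psi N a b t₀ (flowX N a (2 * Real.pi) p.1)) := by
  filter_upwards [eventually_stroboscopicMap_eq hN ha hb t₀ Real.two_pi_pos.le] with p hp
  rw [hp, flowY, psi_add_two_pi]

theorem psi_sub_psi_isBigO (hN : 2 ≤ N) (ha : 0 < a) (hb : 0 < b) (t : ℝ) {ι : Type*}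
    {l : Filter ι} {u v : ι → ℝ} (hu : Tendsto u l (𝓝 0)) (hv : Tendsto v l (𝓝 0)) :
    (fun i => psi N a b t (u i) - psi N a b t (v i)) =O[l] fun i => u i - v i := by
  have h := ((contDiff_psi hN ha hb t).hasStrictFDerivAt (x := 0) (by simp)).isBigO_sub
  have huv : Tendsto (fun i => (u i, v i)) l (𝓝 (0, 0)) := hu.prodMk_nhds hv
  exact h.comp_tendsto huv

theorem truncation_eq_range (c : ℕ → ℝ) (n : ℕ) (t : ℝ) :
    truncation c n t = ∑ k ∈ Finset.range (n + 1), t ^ k * c k := rfl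

theorem truncation_fst (K : ℕ → ℝ × ℝ) (n : ℕ) (t : ℝ) :
    (truncation K n t).1 = truncation (fun k => (K k).1) n t := by
  simp [truncation, Prod.fst_sum]

theorem truncation_snd (K : ℕ → ℝ × ℝ) (n : ℕ) (t : ℝ) :
    (truncation K n t).2 = truncation (fun k => (K k).2) n t := by
  simp [truncation, Prod.snd_sum]

theorem continuous_truncation {E : Type*} [NormedAddCommGroup E] [NormedSpace ℝ E] (c : ℕ → E)
    (n : ℕ) : Continuous (truncation c n) := by
  unfold truncation
  fun_prop

theorem truncation_at_zero {E : Type*} [AddCommGroup E] [Module ℝ E] (c : ℕ → E) (n : ℕ) :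
    truncation c n 0 = c 0 := by
  unfold truncation
  rw [Finset.sum_range_succ', Finset.sum_eq_zero fun k _ => by rw [zero_pow (by omega), zero_smul]]
  simp

theorem tendsto_truncation {E : Type*} [NormedAddCommGroup E] [NormedSpace ℝ E] {c : ℕ → E}
    (h0 : c 0 = 0) (n : ℕ) : Tendsto (truncation c n) (𝓝 0) (𝓝 0) := by
  have h := (continuous_truncation c n).tendsto 0
  rwa [truncation_at_zero, h0] at h

theorem truncation_isBigO {c : ℕ → ℝ} (h0 : c 0 = 0) (n : ℕ) :
    truncation c n =O[𝓝 0] fun t : ℝ => t := by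
  have hd : DifferentiableAt ℝ (truncation c n) 0 := by
    unfold truncation; fun_prop
  have h := hd.isBigO_sub
  simpa [truncation_at_zero, h0] using h

theorem psi_sub_truncation_comp_isBigO (hN : 2 ≤ N) (ha : 0 < a) (hb : 0 < b) (t₀ : ℝ) (n : ℕ)
    {l : Filter ℝ} {u : ℝ → ℝ} (hu : Tendsto u l (𝓝 0)) (hu' : u =O[l] fun t : ℝ => t) :
    (fun t => psi N a b t₀ (u t) - truncation (taylorCoeff (fun x => phi N a b x t₀)) n (u t))
      =O[l] fun t : ℝ => t ^ (n + 1) :=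
  ((psi_sub_truncation_isBigO hN ha hb t₀ (n + 1)).comp_tendsto hu).trans (hu'.pow (n + 1))

theorem taylorCoeff_phi_eq_zero_of_le (hN : 2 ≤ N) (ha : 0 < a) (hb : 0 < b) (t : ℝ) {n : ℕ}
    (hn : n ≤ N) : taylorCoeff (fun x => phi N a b x t) n = 0 :=
  taylorCoeff_phi_of_ne hN ha hb t fun j => by omega

theorem tendsto_dil_rpow (hN : 2 ≤ N) (a T r : ℝ) :
    Tendsto (fun x => dil N a T x ^ r) (𝓝 0) (𝓝 1) := by
  have h := (analyticAt_dil_rpow hN a T r).continuousAt.tendsto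
  simpa [dil, zero_pow (show N - 1 ≠ 0 by omega)] using h

/-- The formal graph of the Taylor series of `φ(·, t₀)` is formally invariant. -/
theorem exists_isFormalSolution_graphSeries (hN : 2 ≤ N) (ha : 0 < a) (hb : 0 < b) (t₀ : ℝ) :
    ∃ R : ℕ → ℝ, IsFormalSolution (stroboscopicMap (field N a b) t₀ (2 * Real.pi))
      (graphSeries (taylorCoeff (fun x => phi N a b x t₀))) R := by
  set c := taylorCoeff (fun x => phi N a b x t₀)
  set X := flowX N a (2 * Real.pi)
  have hc0 : c 0 = 0 := taylorCoeff_phi_eq_zero_of_le hN ha hb t₀ (by omega)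
  have hc1 : c 1 = 0 := taylorCoeff_phi_eq_zero_of_le hN ha hb t₀ (by omega)
  have hX0 : X 0 = 0 := by simp [X, flowX]
  -- The inner dynamics `R` is the Taylor series of the first component of the flow.
  obtain ⟨r, hr0, -, hr⟩ := exists_expansion_of_analyticAt (analyticAt_flowX hN a (2 * Real.pi))
  rw [show flowX N a (2 * Real.pi) 0 = 0 from hX0] at hr0
  have hK0 : graphSeries c 0 = 0 := by simp [graphSeries, hc0]
  refine ⟨r, hK0, by simp [graphSeries, hc1], hr0, fun n => ?_⟩
  have hF := eventually_stroboscopicMap_two_pi_eq hN ha hb t₀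
  have hK := tendsto_truncation hK0 n
  have hXt : Tendsto X (𝓝 0) (𝓝 0) := by
    have := (analyticAt_flowX hN a (2 * Real.pi)).continuousAt.tendsto
    rwa [show flowX N a (2 * Real.pi) 0 = 0 from hX0] at this
  have hw := tendsto_truncation hr0 n
  -- At order zero the truncated first component is `0` rather than the identity, so this case is
  -- separate.
  rcases Nat.eq_zero_or_pos n with rfl | hn
  · refine Asymptotics.IsBigO.congr' (Asymptotics.isBigO_zero _ _) ?_ EventuallyEq.rfl
    filter_upwards [hK.eventually hF] with t ht
    have h0 : ∀ s : ℝ, truncation (graphSeries c) 0 s = 0 := fun s => by simp [truncation, hK0]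
    have h1 : truncation (graphSeries c) 0 t = 0 := h0 t
    rw [ht, h0, h0]
    simp [psi_zero, flowX]
    rfl
  · have hfst : ∀ s, (truncation (graphSeries c) n s).1 = s := fun s => by
      simp [truncation, Prod.fst_sum, graphSeries]
      omega
    have hsnd : ∀ s, (truncation (graphSeries c) n s).2 = truncation c n s := fun s => by
      rw [truncation_snd]; rfl
    have hXw : (fun t => X t - truncation r n t) =O[𝓝 0] fun t : ℝ => t ^ (n + 1) := hr (n + 1)
    -- The second component splits into a Taylor remainder at `t`, the effect on `psi` of truncating
    -- `R`, and a Taylor remainder at the truncated `R`.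
    refine Asymptotics.IsBigO.congr' (f₁ := fun t => (X t - truncation r n t,
      dil N a (2 * Real.pi) t ^ (b / (a * ((N : ℝ) - 1))) * (truncation c n t - psi N a b t₀ t) +
        ((psi N a b t₀ (X t) - psi N a b t₀ (truncation r n t)) +
          (psi N a b t₀ (truncation r n t) - truncation c n (truncation r n t))))) ?_ ?_
      EventuallyEq.rfl
    · refine hXw.prod_left (Asymptotics.IsBigO.add ?_ (Asymptotics.IsBigO.add ?_ ?_))
      · have h1 := (psi_sub_truncation_isBigO hN ha hb t₀ (n + 1)).neg_left
        have h2 := ((tendsto_dil_rpow hN a (2 * Real.pi)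
          (b / (a * ((N : ℝ) - 1)))).isBigO_one ℝ).mul h1
        simpa [truncation_eq_range, c] using h2
      · exact (psi_sub_psi_isBigO hN ha hb t₀ hXt hw).trans hXw
      · exact psi_sub_truncation_comp_isBigO hN ha hb t₀ n hw (truncation_isBigO hr0 n)
    · filter_upwards [hK.eventually hF] with t ht
      rw [ht]
      ext
      · simp only [Prod.fst_sub, hfst, X]
      · simp only [Prod.snd_sub, hfst, hsnd, X]
        ring

theorem isGevrey_graphSeries (hN : 2 ≤ N) (ha : 0 < a) (hb : 0 < b) (t₀ : ℝ) :
    IsGevrey (1 / ((N : ℝ) - 1)) (graphSeries (taylorCoeff (fun x => phi N a b x t₀))) := by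
  obtain ⟨c₁, c₂, hc₁, hc₂, h⟩ := exists_abs_taylorCoeff_phi_le hN ha hb
  -- The entry `1/c₂` accommodates the coefficient `1` of the first component at index one.
  refine ⟨max c₁ (1 / c₂), c₂, by positivity, hc₂, fun n => ?_⟩
  rw [graphSeries, Prod.norm_mk]
  refine max_le ?_ ((h t₀ n).trans ?_)
  · split_ifs with hn
    · subst hn
      rw [norm_one, pow_one, Nat.factorial_one, Nat.cast_one, Real.one_rpow, mul_one]
      exact (div_mul_cancel₀ 1 hc₂.ne').symm.le.trans
        (mul_le_mul_of_nonneg_right (le_max_right _ _) hc₂.le)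
    · rw [norm_zero]; positivity
  · gcongr
    exact le_max_left _ _

end params

/-! ### Lagrange inversion and Gevrey series -/

open PowerSeries in
/-- The residue computation behind Lagrange inversion: if `p = X g` with `h = 1 / g`, then the
coefficient of `X^(n-1)` in `(p^k)' (X / p)^n` is `n` for `k = n` and zero for `1 ≤ k < n`. -/
theorem coeff_derivative_pow_mul_pow {g h : PowerSeries ℝ} (hgh : g * h = 1) (n k : ℕ)
    (hk : k ≤ n) :
    coeff n (derivative ℝ ((X * g) ^ (k + 1)) * h ^ (n + 1)) =
      if k = n then (n : ℝ) + 1 else 0 := by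
  obtain ⟨l, rfl⟩ := Nat.exists_eq_add_of_le hk
  have hpow : ∀ j : ℕ, g ^ j * h ^ j = 1 := fun j => by rw [← mul_pow, hgh, one_pow]
  have hd : derivative ℝ g * h + g * derivative ℝ h = 0 := by
    have := congrArg (derivative ℝ) hgh
    rw [Derivation.leibniz, Derivation.map_one_eq_zero, smul_eq_mul, smul_eq_mul] at this
    linear_combination this
  have hh : derivative ℝ h = -(h ^ 2 * derivative ℝ g) := by
    linear_combination h * hd - derivative ℝ h * hgh
  have e : derivative ℝ ((X * g) ^ (k + 1)) * h ^ (k + l + 1) =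
      X ^ k * ((k + 1 : ℝ) • (h ^ l + X * (h ^ (l + 1) * derivative ℝ g))) := by
    rw [Derivation.leibniz_pow, Derivation.leibniz, derivative_X, Nat.add_sub_cancel]
    simp only [smul_eq_mul, nsmul_eq_mul, mul_one, PowerSeries.smul_eq_C_mul, map_add, map_one,
      map_natCast, Nat.cast_add, Nat.cast_one, mul_pow]
    have h1 := hpow k
    have e1 : h ^ (k + l + 1) = h ^ k * h ^ l * h := by rw [pow_add, pow_add, pow_one]
    have e2 : h ^ (l + 1) = h ^ l * h := pow_succ h l
    rw [e1, e2]
    linear_combination (((k : PowerSeries ℝ) + 1) * X ^ k * (X * derivative ℝ g + g) * h ^ l * h) * h1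
      + (((k : PowerSeries ℝ) + 1) * X ^ k * h ^ l) * hgh
  rw [e, add_comm k l, coeff_X_pow_mul, coeff_smul, map_add]
  cases l with
  | zero => simp
  | succ l =>
    rw [if_neg (by omega)]
    -- The formal counterpart of a derivative having no residue: `(l+1) h^(l+2) g' = -(h^(l+1))'`,
    -- so the two contributions to the coefficient cancel.
    have e3 : (l + 1 : ℝ) * coeff (l + 1) (X * (h ^ (l + 1 + 1) * derivative ℝ g)) =
        -((l + 1 : ℝ) * coeff (l + 1) (h ^ (l + 1))) := by
      have e4 : derivative ℝ (h ^ (l + 1)) =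
          -((l + 1 : ℝ) • (h ^ (l + 1 + 1) * derivative ℝ g)) := by
        rw [Derivation.leibniz_pow, hh, Nat.add_sub_cancel]
        simp only [smul_eq_mul, nsmul_eq_mul, PowerSeries.smul_eq_C_mul, map_add, map_one,
          map_natCast, Nat.cast_add, Nat.cast_one]
        ring
      have e5 := congrArg (coeff l) e4
      rw [coeff_derivative, map_neg, coeff_smul] at e5
      rw [coeff_succ_X_mul]
      linear_combination e5
    have hl : (l + 1 : ℝ) ≠ 0 := by positivity
    have e6 : coeff (l + 1) (X * (h ^ (l + 1 + 1) * derivative ℝ g)) =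
        -coeff (l + 1) (h ^ (l + 1)) := mul_left_cancel₀ hl (by linear_combination e3)
    rw [e6, add_neg_cancel, smul_zero]

open PowerSeries in
/-- Lagrange inversion: if `q = ∑ c_k p^k` with `p = X g` and `h = 1 / g`, then
`(n + 1) c_{n+1}` is the coefficient of `X^n` in `q' h^(n+1)`. -/
theorem lagrange_inversion {g h q : PowerSeries ℝ} (hgh : g * h = 1) {c : ℕ → ℝ}
    (hq : ∀ i, coeff i q = ∑ k ∈ Finset.range (i + 1), c k * coeff i ((X * g) ^ k)) (n : ℕ) :
    coeff n (derivative ℝ q * h ^ (n + 1)) = (n + 1) * c (n + 1) := by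
  have hvan : ∀ i k : ℕ, i < k → coeff i ((X * g) ^ k) = 0 := fun i k hik => by
    rw [mul_pow, coeff_X_pow_mul', if_neg (by omega)]
  have hq' : ∀ i ≤ n + 1, coeff i q = ∑ k ∈ Finset.range (n + 2), c k * coeff i ((X * g) ^ k) := by
    intro i hi
    rw [hq i]
    refine Finset.sum_subset (Finset.range_mono (by omega)) fun k _ hk => ?_
    rw [hvan i k (by simpa using hk), mul_zero]
  -- The coefficient of `X^n` sees only the coefficients of `q` up to `n + 1`, so `q` may be
  -- replaced by a finite combination of powers of `X g`.
  have e : coeff n (derivative ℝ q * h ^ (n + 1)) =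
      coeff n (derivative ℝ (∑ k ∈ Finset.range (n + 2), c k • (X * g) ^ k) * h ^ (n + 1)) := by
    rw [coeff_mul, coeff_mul]
    refine Finset.sum_congr rfl fun x hx => ?_
    have hx' := Finset.HasAntidiagonal.mem_antidiagonal.1 hx
    rw [coeff_derivative, coeff_derivative, hq' _ (by omega), map_sum]
    simp only [coeff_smul, smul_eq_mul]
  rw [e, map_sum, Finset.sum_mul, map_sum, Finset.sum_range_succ']
  have h0 : coeff n (derivative ℝ (c 0 • (X * g) ^ 0) * h ^ (n + 1)) = 0 := by
    rw [pow_zero, Derivation.map_smul, Derivation.map_one_eq_zero, smul_zero, zero_mul, map_zero]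
  rw [h0, add_zero, Finset.sum_eq_single n]
  · rw [Derivation.map_smul, smul_mul_assoc, coeff_smul, coeff_derivative_pow_mul_pow hgh n n le_rfl, if_pos rfl,
      smul_eq_mul, mul_comm]
  · intro k hk hkn
    rw [Derivation.map_smul, smul_mul_assoc, coeff_smul, coeff_derivative_pow_mul_pow hgh n k
      (by have := Finset.mem_range.1 hk; omega), if_neg hkn, smul_zero]
  · intro h; simp at h

theorem factorial_rpow_mul_le {s : ℝ} (hs : 0 ≤ s) (i j : ℕ) :
    (i.factorial : ℝ) ^ s * (j.factorial : ℝ) ^ s ≤ ((i + j).factorial : ℝ) ^ s := by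
  rw [← Real.mul_rpow (by positivity) (by positivity)]
  refine Real.rpow_le_rpow (by positivity) ?_ hs
  exact_mod_cast Nat.le_of_dvd (Nat.factorial_pos _) (Nat.factorial_mul_factorial_dvd_factorial_add i j)

/-- Gevrey bounds with ratio `C` for one factor and `2C` for the other leave this geometric sum in a
convolution, so no factor growing with the number of terms appears. -/
theorem sum_antidiagonal_two_pow_le (n : ℕ) :
    ∑ x ∈ Finset.HasAntidiagonal.antidiagonal n, (2 : ℝ) ^ x.2 ≤ 2 ^ (n + 1) := by
  rw [← Finset.Nat.sum_antidiagonal_swap, Finset.Nat.sum_antidiagonal_eq_sum_range_succ_mk]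
  simp only [Prod.swap]
  have h := geom_sum_eq (show (2 : ℝ) ≠ 1 by norm_num) (n + 1)
  rw [Finset.sum_congr rfl (fun i _ => rfl), h]
  linarith

open PowerSeries in
/-- The inverse of a Gevrey series with constant term `1` is Gevrey. -/
theorem abs_coeff_inverse_le {s C : ℝ} (hs : 0 ≤ s) (hC : 0 ≤ C) {g h : PowerSeries ℝ}
    (hgh : g * h = 1) (hg0 : coeff 0 g = 1)
    (hg : ∀ j, |coeff (j + 1) g| ≤ C ^ (j + 1) * ((j + 1).factorial : ℝ) ^ s) (j : ℕ) :
    |coeff j h| ≤ (2 * C) ^ j * (j.factorial : ℝ) ^ s := by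
  induction j using Nat.strong_induction_on with
  | _ j ih =>
    have hj := congrArg (coeff j) hgh
    rw [coeff_mul] at hj
    cases j with
    | zero =>
      simp only [Finset.HasAntidiagonal.antidiagonal_zero, Finset.sum_singleton, hg0, one_mul] at hj
      rw [hj]; simp
    | succ j =>
      rw [Finset.Nat.antidiagonal_succ, Finset.sum_cons, Finset.sum_map, coeff_one,
        if_neg (by omega)] at hj
      simp only [hg0, one_mul, Function.Embedding.prodMap, Function.Embedding.coeFn_mk, Prod.map,
        Function.Embedding.refl_apply, Nat.succ_eq_add_one] at hj
      -- The recursion expresses the next coefficient of the inverse through the earlier ones.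
      rw [eq_neg_of_add_eq_zero_left hj, abs_neg]
      calc |∑ x ∈ Finset.HasAntidiagonal.antidiagonal j, coeff (x.1 + 1) g * coeff x.2 h|
          ≤ ∑ x ∈ Finset.HasAntidiagonal.antidiagonal j,
              C ^ (j + 1) * ((j + 1).factorial : ℝ) ^ s * (2 : ℝ) ^ x.2 := by
            refine (Finset.abs_sum_le_sum_abs _ _).trans (Finset.sum_le_sum fun x hx => ?_)
            have hx' := Finset.HasAntidiagonal.mem_antidiagonal.1 hx
            rw [abs_mul]
            refine (mul_le_mul (hg x.1) (ih x.2 (by omega)) (abs_nonneg _)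
              (by positivity)).trans ?_
            have h1 := factorial_rpow_mul_le hs (x.1 + 1) x.2
            rw [show x.1 + 1 + x.2 = j + 1 by omega] at h1
            calc _ = (C ^ (x.1 + 1) * C ^ x.2 * 2 ^ x.2) * (((x.1 + 1).factorial : ℝ) ^ s *
                  (x.2.factorial : ℝ) ^ s) := by rw [mul_pow]; ring
              _ ≤ (C ^ (x.1 + 1) * C ^ x.2 * 2 ^ x.2) * ((j + 1).factorial : ℝ) ^ s :=
                  mul_le_mul_of_nonneg_left h1 (by positivity)
              _ = _ := by rw [← pow_add, show x.1 + 1 + x.2 = j + 1 by omega]; ring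
        _ ≤ C ^ (j + 1) * ((j + 1).factorial : ℝ) ^ s * 2 ^ (j + 1) := by
            rw [← Finset.mul_sum]
            exact mul_le_mul_of_nonneg_left (sum_antidiagonal_two_pow_le j) (by positivity)
        _ = _ := by rw [mul_pow]; ring

open PowerSeries in
-- The dependence on `k` is only geometric. This is essential, since Lagrange inversion takes the
-- power `n + 1` at the coefficient `n`.
theorem abs_coeff_pow_le {s C : ℝ} (hs : 0 ≤ s) (hC : 0 ≤ C) {h : PowerSeries ℝ}
    (hh : ∀ j, |coeff j h| ≤ C ^ j * (j.factorial : ℝ) ^ s) (k j : ℕ) :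
    |coeff j (h ^ k)| ≤ 2 ^ k * (2 * C) ^ j * (j.factorial : ℝ) ^ s := by
  induction k generalizing j with
  | zero =>
    rw [pow_zero, coeff_one]
    split_ifs with hj
    · subst hj; simp
    · rw [abs_zero]; positivity
  | succ k ih =>
    rw [pow_succ', coeff_mul]
    calc |∑ x ∈ Finset.HasAntidiagonal.antidiagonal j, coeff x.1 h * coeff x.2 (h ^ k)|
        ≤ ∑ x ∈ Finset.HasAntidiagonal.antidiagonal j, 2 ^ k * C ^ j * (j.factorial : ℝ) ^ s * (2 : ℝ) ^ x.2 := by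
          refine (Finset.abs_sum_le_sum_abs _ _).trans (Finset.sum_le_sum fun x hx => ?_)
          have hx' := Finset.HasAntidiagonal.mem_antidiagonal.1 hx
          rw [abs_mul]
          refine (mul_le_mul (hh x.1) (ih x.2) (abs_nonneg _) (by positivity)).trans ?_
          have h1 := factorial_rpow_mul_le hs x.1 x.2
          rw [hx'] at h1
          calc _ = (2 ^ k * (C ^ x.1 * C ^ x.2) * 2 ^ x.2) * ((x.1.factorial : ℝ) ^ s *
                (x.2.factorial : ℝ) ^ s) := by rw [mul_pow]; ring
            _ ≤ (2 ^ k * (C ^ x.1 * C ^ x.2) * 2 ^ x.2) * (j.factorial : ℝ) ^ s :=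
                mul_le_mul_of_nonneg_left h1 (by positivity)
            _ = _ := by rw [← pow_add, hx']; ring
      _ ≤ 2 ^ k * C ^ j * (j.factorial : ℝ) ^ s * 2 ^ (j + 1) := by
          rw [← Finset.mul_sum]
          exact mul_le_mul_of_nonneg_left (sum_antidiagonal_two_pow_le j) (by positivity)
      _ = _ := by rw [mul_pow]; ring

open PowerSeries in
/-- If `q = ∑ c_k p^k` with `p = X + ⋯` and both `p`, `q` are Gevrey of order `s`, then so is `c`. -/
theorem isGevrey_of_comp {s : ℝ} (hs : 0 ≤ s) {p q c : ℕ → ℝ} (hp0 : p 0 = 0) (hp1 : p 1 = 1)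
    (hp : IsGevrey s p) (hq : IsGevrey s q)
    (hcomp : ∀ i, q i = ∑ k ∈ Finset.range (i + 1), c k * coeff i (PowerSeries.mk p ^ k)) :
    IsGevrey s c := by
  obtain ⟨c₁, c₂, hc₁, hc₂, hp⟩ := hp
  obtain ⟨d₁, d₂, hd₁, hd₂, hq⟩ := hq
  set g : PowerSeries ℝ := PowerSeries.mk fun j => p (j + 1) with hg
  have hpg : PowerSeries.mk p = X * g := by
    ext i
    cases i with
    | zero => simp [hp0]
    | succ i => rw [coeff_succ_X_mul, coeff_mk, hg, coeff_mk]
  have hg0 : coeff 0 g = 1 := by rw [hg, coeff_mk, zero_add, hp1]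
  have hgh : g * g⁻¹ = 1 := PowerSeries.mul_inv_cancel g (by
    rw [← coeff_zero_eq_constantCoeff_apply, hg0]; exact one_ne_zero)
  -- Removing a factor `X` shifts the index: `c₁ c₂` is absorbed in the maximum, and `2^s` pays for
  -- `j + 2 ≤ 2^(j+1)`.
  set C := max 1 (c₁ * c₂) * (c₂ * 2 ^ s) with hC
  have hC0 : 0 ≤ C := by positivity
  have hgb : ∀ j, |coeff (j + 1) g| ≤ C ^ (j + 1) * ((j + 1).factorial : ℝ) ^ s := by
    intro j
    rw [hg, coeff_mk]
    refine (hp (j + 1 + 1)).trans ?_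
    have h1 : (((j + 1 + 1).factorial : ℕ) : ℝ) ^ s ≤
        (2 ^ s) ^ (j + 1) * ((j + 1).factorial : ℝ) ^ s := by
      rw [Nat.factorial_succ, Nat.cast_mul, Real.mul_rpow (by positivity) (by positivity)]
      refine mul_le_mul_of_nonneg_right ?_ (by positivity)
      rw [← Real.rpow_natCast, ← Real.rpow_mul (by norm_num), mul_comm s, Real.rpow_mul (by norm_num),
        Real.rpow_natCast]
      refine Real.rpow_le_rpow (by positivity) ?_ hs
      exact_mod_cast Nat.lt_two_pow_self (n := j + 1)
    have h2 : c₁ * c₂ ≤ max 1 (c₁ * c₂) ^ (j + 1) :=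
      (le_max_right 1 _).trans (le_self_pow₀ (le_max_left _ _) (by omega))
    calc c₁ * c₂ ^ (j + 1 + 1) * (((j + 1 + 1).factorial : ℕ) : ℝ) ^ s
        ≤ c₁ * c₂ ^ (j + 1 + 1) * ((2 ^ s) ^ (j + 1) * ((j + 1).factorial : ℝ) ^ s) :=
          mul_le_mul_of_nonneg_left h1 (by positivity)
      _ = (c₁ * c₂) * ((c₂ * 2 ^ s) ^ (j + 1) * ((j + 1).factorial : ℝ) ^ s) := by
          rw [mul_pow]; ring
      _ ≤ max 1 (c₁ * c₂) ^ (j + 1) * ((c₂ * 2 ^ s) ^ (j + 1) * ((j + 1).factorial : ℝ) ^ s) :=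
          mul_le_mul_of_nonneg_right h2 (by positivity)
      _ = _ := by rw [hC, mul_pow]; ring
  have hhb := abs_coeff_pow_le hs (by positivity) (abs_coeff_inverse_le hs hC0 hgh hg0 hgb)
  set M := max d₂ (2 * (2 * C)) with hM
  have hM0 : 0 < M := lt_max_of_lt_left hd₂
  -- One factor `2` comes from the power of the inverse series. Differentiation and the number of
  -- terms give `(n+1)²`; Lagrange's formula cancels one `n + 1`, and the other is at most
  -- `2^(n+1)`.
  refine ⟨d₁, 4 * M, hd₁, by positivity, fun n => ?_⟩
  cases n with
  | zero =>
    have h0 := hcomp 0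
    simp only [zero_add, Finset.sum_range_one, pow_zero, coeff_one, if_true, mul_one] at h0
    rw [← h0]
    simpa using hq 0
  | succ n =>
    have hL := lagrange_inversion (q := PowerSeries.mk q) hgh (c := c)
      (fun i => by rw [coeff_mk, hcomp i, hpg]) n
    have hbound : |coeff n (derivative ℝ (PowerSeries.mk q) * g⁻¹ ^ (n + 1))| ≤
        (n + 1) * ((n + 1) * (d₁ * (2 * M) ^ (n + 1) * ((n + 1).factorial : ℝ) ^ s)) := by
      rw [coeff_mul]
      refine (Finset.abs_sum_le_sum_abs _ _).trans
        ((Finset.sum_le_card_nsmul _ _ ((n + 1) * (d₁ * (2 * M) ^ (n + 1) *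
          ((n + 1).factorial : ℝ) ^ s)) fun x hx => ?_).trans_eq ?_)
      · have hx' := Finset.HasAntidiagonal.mem_antidiagonal.1 hx
        rw [abs_mul, coeff_derivative, coeff_mk, abs_mul]
        have h1 := factorial_rpow_mul_le hs (x.1 + 1) x.2
        rw [show x.1 + 1 + x.2 = n + 1 by omega] at h1
        have h2 : |((x.1 : ℝ) + 1)| ≤ n + 1 := by
          rw [abs_of_nonneg (by positivity)]
          have : (x.1 : ℝ) ≤ n := by exact_mod_cast (by omega : x.1 ≤ n)
          linarith
        calc |q (x.1 + 1)| * |((x.1 : ℝ) + 1)| * |coeff x.2 (g⁻¹ ^ (n + 1))|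
            ≤ (d₁ * M ^ (x.1 + 1) * ((x.1 + 1).factorial : ℝ) ^ s) * (n + 1) *
              (2 ^ (n + 1) * M ^ x.2 * (x.2.factorial : ℝ) ^ s) := by
              refine mul_le_mul (mul_le_mul ((hq _).trans ?_) h2 (abs_nonneg _) (by positivity))
                ((hhb _ _).trans ?_) (abs_nonneg _) (by positivity)
              · gcongr
                exact le_max_left _ _
              · gcongr
                exact le_max_right _ _
          _ = (n + 1) * (d₁ * (2 ^ (n + 1) * (M ^ (x.1 + 1) * M ^ x.2))) *
              (((x.1 + 1).factorial : ℝ) ^ s * (x.2.factorial : ℝ) ^ s) := by ring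
          _ ≤ (n + 1) * (d₁ * (2 ^ (n + 1) * (M ^ (x.1 + 1) * M ^ x.2))) *
              ((n + 1).factorial : ℝ) ^ s := mul_le_mul_of_nonneg_left h1 (by positivity)
          _ = _ := by
              rw [← pow_add, show x.1 + 1 + x.2 = n + 1 by omega, mul_pow]; ring
      · rw [Finset.Nat.card_antidiagonal, nsmul_eq_mul]; push_cast; ring
    rw [hL, abs_mul, abs_of_nonneg (by positivity : (0 : ℝ) ≤ (n : ℝ) + 1)] at hbound
    have h3 := le_of_mul_le_mul_left hbound (by positivity)
    rw [Real.norm_eq_abs]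
    refine h3.trans ?_
    have h4 : (n + 1 : ℝ) ≤ 2 ^ (n + 1) := by exact_mod_cast (Nat.lt_two_pow_self (n := n + 1)).le
    calc (n + 1 : ℝ) * (d₁ * (2 * M) ^ (n + 1) * ((n + 1).factorial : ℝ) ^ s)
        ≤ 2 ^ (n + 1) * (d₁ * (2 * M) ^ (n + 1) * ((n + 1).factorial : ℝ) ^ s) :=
          mul_le_mul_of_nonneg_right h4 (by positivity)
      _ = _ := by rw [mul_pow, mul_pow, show (4 : ℝ) = 2 * 2 by norm_num, mul_pow]; ring

/-! ### Rigidity of formal solutions -/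

theorem exists_eq_add_mul_of_hasDerivAt {f : ℝ → ℝ} {f' : ℝ} (hf : HasDerivAt f f' 0) :
    ∃ h : ℝ → ℝ, Tendsto h (𝓝 0) (𝓝 f') ∧ ∀ v, f v = f 0 + v * h v := by
  refine ⟨dslope f 0, ?_, fun v => ?_⟩
  · have h := (continuousAt_dslope_same.2 hf.differentiableAt).tendsto
    rwa [dslope_same, hf.deriv] at h
  · have h := sub_smul_dslope f 0 v
    rw [sub_zero, smul_eq_mul] at h
    rw [h]; ring

theorem tendsto_div_pow_of_isBigO {f : ℝ → ℝ} {j n : ℕ} (hj : j < n)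
    (hf : f =O[𝓝[>] 0] fun t : ℝ => t ^ n) :
    Tendsto (fun t => f t / t ^ j) (𝓝[>] 0) (𝓝 0) :=
  (hf.trans_isLittleO
    ((Asymptotics.isLittleO_pow_pow hj).mono nhdsWithin_le_nhds)).tendsto_div_nhds_zero

theorem hasDerivAt_truncation (c : ℕ → ℝ) {n : ℕ} (hn : 1 ≤ n) :
    HasDerivAt (truncation c n) (c 1) 0 := by
  have h : HasDerivAt (fun t : ℝ => ∑ k ∈ Finset.range (n + 1), t ^ k * c k)
      (∑ k ∈ Finset.range (n + 1), ((k : ℝ) * 0 ^ (k - 1)) * c k) 0 :=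
    HasDerivAt.fun_sum fun k _ => (hasDerivAt_pow k 0).mul_const (c k)
  rw [Finset.sum_eq_single 1] at h
  · rw [show ((1 : ℕ) : ℝ) * 0 ^ (1 - 1) * c 1 = c 1 by simp] at h
    exact h
  · intro k _ hk
    rcases Nat.eq_zero_or_pos k with rfl | hk0
    · simp
    · rw [zero_pow (by omega)]; ring
  · intro h1
    exact absurd (Finset.mem_range.2 (by omega)) h1

theorem contDiff_truncation (c : ℕ → ℝ) (n : ℕ) : ContDiff ℝ 1 (truncation c n) := by
  unfold truncation; fun_prop

theorem hasStrictDerivAt_truncation (c : ℕ → ℝ) {n : ℕ} (hn : 1 ≤ n) :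
    HasStrictDerivAt (truncation c n) (c 1) 0 :=
  (contDiff_truncation c n).contDiffAt.hasStrictDerivAt' (hasDerivAt_truncation c hn) one_ne_zero

/-- If `p(r(t)) - p(t) ∼ -A t^N` with `p(t) = t + ⋯`, then `r(t) - t ∼ -A t^N`. -/
theorem tendsto_sub_div_pow_of_comp {p r : ℝ → ℝ} {N : ℕ} {A : ℝ} (hp : HasStrictDerivAt p 1 0)
    (hr : Tendsto r (𝓝[>] 0) (𝓝 0))
    (h : Tendsto (fun t => (p (r t) - p t) / t ^ N) (𝓝[>] 0) (𝓝 A)) :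
    Tendsto (fun t => (r t - t) / t ^ N) (𝓝[>] 0) (𝓝 A) := by
  have hid : Tendsto (fun t : ℝ => t) (𝓝[>] 0) (𝓝 0) := nhdsWithin_le_nhds
  have hrt : Tendsto (fun t => (r t, t)) (𝓝[>] 0) (𝓝 ((0 : ℝ), (0 : ℝ))) := hr.prodMk_nhds hid
  have ho := hp.isLittleO.comp_tendsto hrt
  obtain ⟨φ, hφ, hφe⟩ := Asymptotics.isLittleO_iff_exists_eq_mul.1 ho
  have h1 : Tendsto (fun t => 1 + φ t) (𝓝[>] 0) (𝓝 1) := by simpa using hφ.const_add 1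
  have h2 := h.div h1 one_ne_zero
  rw [div_one] at h2
  refine h2.congr' ?_
  filter_upwards [hφe, h1.eventually_ne one_ne_zero] with t ht hne
  simp only [Function.comp_apply, Pi.mul_apply] at ht
  -- Strict differentiability gives `p(r) - p(t) = (r - t)(1 + o(1))`.
  have e : p (r t) - p t = (r t - t) * (1 + φ t) := by
    simp at ht
    linear_combination ht
  simp only [Pi.div_apply]
  rw [e, mul_div_right_comm, mul_div_assoc, div_self hne, mul_one]

/-- The polynomial whose evaluation is a truncation. -/
noncomputable def truncPoly (c : ℕ → ℝ) (n : ℕ) : Polynomial ℝ :=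
  ∑ k ∈ Finset.range (n + 1), Polynomial.C (c k) * Polynomial.X ^ k

theorem eval_truncPoly (c : ℕ → ℝ) (n : ℕ) (t : ℝ) :
    (truncPoly c n).eval t = truncation c n t := by
  simp only [truncPoly, Polynomial.eval_finsetSum, Polynomial.eval_mul, Polynomial.eval_C,
    Polynomial.eval_pow, Polynomial.eval_X, truncation_eq_range, mul_comm]

/-- A polynomial `D` with `U D - D ∘ r = O(t^(n+1))`, where `U - 1 ∼ B t^m`, `B > 0`, and
`r - t ∼ -A t^(m+1)`, `A ≥ 0`, vanishes to order `n + 1 - m`. -/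
theorem X_pow_dvd_of_semiconj {D : Polynomial ℝ} {U r : ℝ → ℝ} {A B : ℝ} {m n : ℕ} (hm : 1 ≤ m)
    (hA : 0 ≤ A) (hB : 0 < B)
    (hU : Tendsto (fun t => (U t - 1) / t ^ m) (𝓝[>] 0) (𝓝 B))
    (hr : Tendsto (fun t => (r t - t) / t ^ (m + 1)) (𝓝[>] 0) (𝓝 (-A)))
    (hD : (fun t => U t * D.eval t - D.eval (r t)) =O[𝓝[>] 0] fun t : ℝ => t ^ (n + 1)) :
    Polynomial.X ^ (n + 1 - m) ∣ D := by
  by_cases hD0 : D = 0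
  · simp [hD0]
  obtain ⟨Q, hQ, hQ'⟩ := Polynomial.exists_eq_pow_rootMultiplicity_mul_and_not_dvd D hD0 0
  simp only [map_zero, sub_zero] at hQ hQ'
  rw [Polynomial.X_dvd_iff, Polynomial.coeff_zero_eq_eval_zero] at hQ'
  set k := D.rootMultiplicity 0
  by_contra hnd
  have hkn : k + m < n + 1 := by
    by_contra hle
    exact hnd (hQ ▸ (pow_dvd_pow _ (by omega)).mul_right Q)
  apply hQ'
  have hid : Tendsto (fun t : ℝ => t) (𝓝[>] 0) (𝓝 0) := nhdsWithin_le_nhds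
  have hpos : ∀ᶠ t : ℝ in 𝓝[>] 0, 0 < t := self_mem_nhdsWithin
  have htm : Tendsto (fun t : ℝ => t ^ m) (𝓝[>] 0) (𝓝 0) := by
    simpa [zero_pow (show m ≠ 0 by omega)] using hid.pow m
  -- the relative displacement
  have hwm : Tendsto (fun t => (r t - t) / t / t ^ m) (𝓝[>] 0) (𝓝 (-A)) := by
    refine hr.congr fun t => ?_
    rw [div_div, pow_succ']
  have hw : Tendsto (fun t => (r t - t) / t) (𝓝[>] 0) (𝓝 0) := by
    have := hwm.mul htm
    rw [mul_zero] at this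
    refine this.congr' ?_
    filter_upwards [hpos] with t ht
    rw [div_mul_cancel₀ _ (pow_ne_zero m ht.ne')]
  have hδm : Tendsto (fun t => (r t - t) / t ^ m) (𝓝[>] 0) (𝓝 0) := by
    have := hwm.mul hid
    rw [mul_zero] at this
    refine this.congr' ?_
    filter_upwards [hpos] with t ht
    field_simp
  have hrt : Tendsto r (𝓝[>] 0) (𝓝 0) := by
    have := (hw.mul hid).add hid
    rw [zero_mul, zero_add] at this
    refine this.congr' ?_
    filter_upwards [hpos] with t ht
    rw [div_mul_cancel₀ _ ht.ne', sub_add_cancel]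
  obtain ⟨h, hh, hhe⟩ := exists_eq_add_mul_of_hasDerivAt (f := fun w : ℝ => (1 + w) ^ k) (f' := k)
    (by simpa using ((hasDerivAt_id (0 : ℝ)).const_add 1).fun_pow k)
  have hpow : Tendsto (fun t => ((1 + (r t - t) / t) ^ k - 1) / t ^ m) (𝓝[>] 0)
      (𝓝 (-A * k)) := by
    refine (hwm.mul (hh.comp hw)).congr fun t => ?_
    rw [hhe]
    simp only [Function.comp_apply, add_zero, one_pow]
    ring
  have hpow1 : Tendsto (fun t => (1 + (r t - t) / t) ^ k) (𝓝[>] 0) (𝓝 1) := by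
    simpa using (hw.const_add 1).pow k
  have hQt : Tendsto (fun t => Q.eval t) (𝓝[>] 0) (𝓝 (Q.eval 0)) :=
    (Q.continuous.tendsto 0).comp hid
  have hQr : Tendsto (fun t => (Q.eval (r t) - Q.eval t) / t ^ m) (𝓝[>] 0) (𝓝 0) := by
    have hs : HasStrictDerivAt (fun t => Q.eval t) (Q.derivative.eval 0) 0 := Q.hasStrictDerivAt 0
    have h1 := hs.hasStrictFDerivAt.isBigO_sub.comp_tendsto (hrt.prodMk_nhds hid)
    have h2 := h1.mul (Asymptotics.isBigO_refl (fun t : ℝ => (t ^ m)⁻¹) (𝓝[>] 0))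
    exact h2.trans_tendsto hδm
  -- With `D = t^k Q`, the equation divided by `t^(k+m)` has limit `(B + A k) Q(0)`; if `k + m < n +
  -- 1` this limit is zero.
  have hlim := ((hU.mul hQt).sub (hpow.mul hQt)).sub (hpow1.mul hQr)
  have hzero := tendsto_div_pow_of_isBigO hkn hD
  have heq : ∀ᶠ t in 𝓝[>] (0 : ℝ), (U t * D.eval t - D.eval (r t)) / t ^ (k + m) =
      (U t - 1) / t ^ m * Q.eval t - ((1 + (r t - t) / t) ^ k - 1) / t ^ m * Q.eval t -
        (1 + (r t - t) / t) ^ k * ((Q.eval (r t) - Q.eval t) / t ^ m) := by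
    filter_upwards [hpos] with t ht
    have e1 : 1 + (r t - t) / t = r t / t := by field_simp; ring
    rw [e1, hQ]
    simp only [Polynomial.eval_mul, Polynomial.eval_pow, Polynomial.eval_X]
    rw [div_pow]
    field_simp
    ring
  have := tendsto_nhds_unique hlim (hzero.congr' heq)
  have h3 : (B + A * k) * Q.eval 0 = 0 := by linear_combination this
  have h4 : B + A * k ≠ 0 := by positivity
  exact (mul_eq_zero.1 h3).resolve_left h4

section params

variable {N : ℕ} {a b : ℝ}

theorem tendsto_dil_rpow_sub_div (hN : 2 ≤ N) (a T β : ℝ) {p : ℝ → ℝ}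
    (hp : Tendsto (fun t => p t / t) (𝓝[>] 0) (𝓝 1)) (hp0 : Tendsto p (𝓝[>] 0) (𝓝 0)) :
    Tendsto (fun t => (dil N a T (p t) ^ β - 1) / t ^ (N - 1)) (𝓝[>] 0)
      (𝓝 (a * ((N : ℝ) - 1) * T * β)) := by
  obtain ⟨h, hh, hhe⟩ := exists_eq_add_mul_of_hasDerivAt (hasDerivAt_one_add_rpow β)
  have h1 : Tendsto (fun t => a * ((N : ℝ) - 1) * T * (p t) ^ (N - 1)) (𝓝[>] 0) (𝓝 0) :=
    (tendsto_mul_pow_zero (show N - 1 ≠ 0 by omega) _).comp hp0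
  have h2 := ((hp.pow (N - 1)).const_mul (a * ((N : ℝ) - 1) * T)).mul (hh.comp h1)
  rw [one_pow, mul_one] at h2
  refine h2.congr fun t => ?_
  rw [dil, hhe]
  simp only [Function.comp_apply, add_zero, Real.one_rpow, div_pow]
  ring

/-- The second component of a formal solution is the composition of the Taylor series of `φ` with
the first one. -/
theorem X_pow_dvd_of_isFormalSolution (hN : 2 ≤ N) (ha : 0 < a) (hb : 0 < b) (t₀ : ℝ)
    {K : ℕ → ℝ × ℝ} {R : ℕ → ℝ}
    (hKR : IsFormalSolution (stroboscopicMap (field N a b) t₀ (2 * Real.pi)) K R) {n : ℕ}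
    (hn : N ≤ n) :
    Polynomial.X ^ (n + 1 - (N - 1)) ∣ truncPoly (fun k => (K k).2) n -
      (truncPoly (taylorCoeff (fun x => phi N a b x t₀)) n).comp
        (truncPoly (fun k => (K k).1) n) := by
  have hN1 := natCast_sub_one_pos hN
  have hpi := Real.pi_pos
  obtain ⟨hK0, hK1, hR0, hinv⟩ := hKR
  set c := taylorCoeff (fun x => phi N a b x t₀)
  set T := 2 * Real.pi with hT
  set β := b / (a * ((N : ℝ) - 1)) with hβ
  set p := truncation (fun k => (K k).1) n
  set q := truncation (fun k => (K k).2) n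
  set r := truncation R n
  set l : Filter ℝ := 𝓝[>] 0
  have hl : l ≤ 𝓝 0 := nhdsWithin_le_nhds
  have hid : Tendsto (fun t : ℝ => t) l (𝓝 0) := hl
  have hpos : ∀ᶠ t : ℝ in l, 0 < t := self_mem_nhdsWithin
  have hp00 : (fun k => (K k).1) 0 = 0 := by simp [hK0]
  have hp01 : (fun k => (K k).1) 1 = 1 := by simp [hK1]
  have hp0 : Tendsto p l (𝓝 0) := (tendsto_truncation hp00 n).mono_left hl
  have hr0 : Tendsto r l (𝓝 0) := (tendsto_truncation hR0 n).mono_left hl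
  have hpO : p =O[l] fun t : ℝ => t := (truncation_isBigO hp00 n).mono hl
  have hrO : r =O[l] fun t : ℝ => t := (truncation_isBigO hR0 n).mono hl
  have hpr0 : Tendsto (fun t => p (r t)) l (𝓝 0) := (tendsto_truncation hp00 n).comp hr0
  have hprO : (fun t => p (r t)) =O[l] fun t : ℝ => t :=
    ((truncation_isBigO hp00 n).comp_tendsto hr0).trans hrO
  have hXc := (analyticAt_flowX hN a T).continuousAt.tendsto
  rw [show flowX N a T 0 = 0 by simp [flowX]] at hXc
  have hXp : Tendsto (fun t => flowX N a T (p t)) l (𝓝 0) := hXc.comp hp0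
  have hps := hasStrictDerivAt_truncation (fun k => (K k).1) (n := n) (by omega)
  rw [show (K 1).1 = 1 from hp01] at hps
  have hpt : Tendsto (fun t => p t / t) l (𝓝 1) := by
    have h := hps.hasDerivAt.tendsto_slope_zero_right
    refine h.congr fun t => ?_
    rw [zero_add, truncation_at_zero, show (K 0).1 = 0 from hp00, sub_zero, smul_eq_mul]
    ring
  -- the two components of the invariance equation
  have hF := ((tendsto_truncation hK0 n).mono_left hl).eventually
    (eventually_stroboscopicMap_two_pi_eq hN ha hb t₀)
  have hE := ((hinv n).mono hl).congr' (f₂ := fun t => (flowX N a T (p t) - p (r t),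
      dil N a T (p t) ^ β * (q t - psi N a b t₀ (p t)) + psi N a b t₀ (flowX N a T (p t)) -
        q (r t))) (hF.mono fun t ht => by
    change stroboscopicMap (field N a b) t₀ (2 * Real.pi) (truncation K n t) -
      truncation K n (truncation R n t) = _
    rw [ht, truncation_fst, truncation_snd]
    ext
    · simp only [Prod.fst_sub, truncation_fst]; rfl
    · simp only [Prod.snd_sub, truncation_snd]; rfl) EventuallyEq.rfl
  have hE1 : (fun t => flowX N a T (p t) - p (r t)) =O[l] fun t : ℝ => t ^ (n + 1) :=
    hE.prod_left_fst
  have hE2 := hE.prod_left_snd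
  -- the displacement of the conjugated one-dimensional map
  have hXdiv : Tendsto (fun t => (flowX N a T (p t) - p t) / t ^ N) l (𝓝 (-(T * a))) := by
    have h := hpt.mul (tendsto_dil_rpow_sub_div hN a T (-(1 / ((N : ℝ) - 1))) hpt hp0)
    rw [show 1 * (a * ((N : ℝ) - 1) * T * -(1 / ((N : ℝ) - 1))) = -(T * a) by
      field_simp] at h
    refine h.congr fun t => ?_
    have e : t ^ N = t * t ^ (N - 1) := by rw [← pow_succ']; congr 1; omega
    rw [e, flowX, div_mul_div_comm]
    congr 1
    ring
  have hrdiv : Tendsto (fun t => (r t - t) / t ^ N) l (𝓝 (-(T * a))) := by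
    -- To leading order, conjugation by `p = t + ⋯` does not change the displacement `-2πa t^N` of
    -- the flow.
    refine tendsto_sub_div_pow_of_comp hps hr0 ?_
    have h := hXdiv.sub (tendsto_div_pow_of_isBigO (show N < n + 1 by omega) hE1)
    rw [sub_zero] at h
    refine h.congr fun t => ?_
    ring
  -- the defect of the second component
  have hU1 : (fun t => dil N a T (p t) ^ β) =O[l] fun _ : ℝ => (1 : ℝ) :=
    ((tendsto_dil_rpow hN a T β).comp hp0).isBigO_one ℝ
  have h1 := (psi_sub_psi_isBigO hN ha hb t₀ hXp hpr0).trans hE1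
  have h2 := hU1.mul (psi_sub_truncation_comp_isBigO hN ha hb t₀ n hp0 hpO)
  have h3 := psi_sub_truncation_comp_isBigO hN ha hb t₀ n hpr0 hprO
  simp only [one_mul] at h2
  refine X_pow_dvd_of_semiconj (U := fun t => dil N a T (p t) ^ β) (r := r) (A := T * a)
    (B := T * b) (m := N - 1) (by omega) (by positivity) (by positivity) ?_ ?_ ?_
  · have h := tendsto_dil_rpow_sub_div hN a T β hpt hp0
    rwa [show a * ((N : ℝ) - 1) * T * β = T * b by rw [hβ]; field_simp] at h
  · rwa [show N - 1 + 1 = N by omega]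
  · refine (((hE2.sub h1).add h2).sub h3).congr_left fun t => ?_
    simp only [Polynomial.eval_sub, Polynomial.eval_comp, eval_truncPoly]
    ring

theorem coeff_truncPoly (c : ℕ → ℝ) {n i : ℕ} (hi : i ≤ n) : (truncPoly c n).coeff i = c i := by
  simp only [truncPoly, Polynomial.finsetSum_coeff, Polynomial.coeff_C_mul, Polynomial.coeff_X_pow]
  simp
  omega

theorem truncPoly_eq_trunc (c : ℕ → ℝ) (n : ℕ) :
    truncPoly c n = PowerSeries.trunc (n + 1) (PowerSeries.mk c) := by
  ext i
  rw [PowerSeries.coeff_trunc, PowerSeries.coeff_mk]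
  simp only [truncPoly, Polynomial.finsetSum_coeff, Polynomial.coeff_C_mul, Polynomial.coeff_X_pow]
  simp

/-- As `p` has no constant term, powers `p^k` with `k > i` do not reach degree `i`, so truncated
composition agrees with formal composition there. -/
theorem coeff_comp_truncPoly {c p : ℕ → ℝ} (hp : p 0 = 0) {i n : ℕ} (hi : i ≤ n) :
    ((truncPoly c n).comp (truncPoly p n)).coeff i =
      ∑ k ∈ Finset.range (i + 1), c k * PowerSeries.coeff i (PowerSeries.mk p ^ k) := by
  have h1 : ∀ k, (truncPoly p n ^ k).coeff i = PowerSeries.coeff i (PowerSeries.mk p ^ k) := by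
    intro k
    rw [truncPoly_eq_trunc, ← Polynomial.coeff_coe, Polynomial.coe_pow,
      ← PowerSeries.coeff_coe_trunc_of_lt (n := i) (m := n + 1) (by omega), PowerSeries.trunc_trunc_pow,
      PowerSeries.coeff_coe_trunc_of_lt (by omega)]
  have h2 : ∀ k, i < k → PowerSeries.coeff i (PowerSeries.mk p ^ k) = 0 := by
    intro k hk
    have hX : (PowerSeries.X : PowerSeries ℝ) ∣ PowerSeries.mk p := by
      rw [PowerSeries.X_dvd_iff, ← PowerSeries.coeff_zero_eq_constantCoeff_apply,
        PowerSeries.coeff_mk, hp]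
    exact PowerSeries.X_pow_dvd_iff.1 (pow_dvd_pow_of_dvd hX k) i hk
  have h3 : (truncPoly c n).comp (truncPoly p n) =
      ∑ k ∈ Finset.range (n + 1), Polynomial.C (c k) * truncPoly p n ^ k := by
    rw [truncPoly, Polynomial.sum_comp]
    simp [Polynomial.mul_comp]
  rw [h3, Polynomial.finsetSum_coeff]
  simp only [Polynomial.coeff_C_mul, h1]
  symm
  refine Finset.sum_subset (Finset.range_mono (by omega)) fun k _ hk => ?_
  rw [h2 k (by simpa using hk), mul_zero]

theorem not_isGevrey_of_isFormalSolution (hN : 2 ≤ N) (ha : 0 < a) (hb : 0 < b) (t₀ : ℝ)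
    {K : ℕ → ℝ × ℝ} {R : ℕ → ℝ}
    (hKR : IsFormalSolution (stroboscopicMap (field N a b) t₀ (2 * Real.pi)) K R) {s : ℝ}
    (hs : 0 ≤ s) (hs' : s < 1 / ((N : ℝ) - 1)) : ¬ IsGevrey s K := by
  rintro ⟨c₁, c₂, hc₁, hc₂, hK⟩
  have hp0 : (fun k => (K k).1) 0 = 0 := by simp [hKR.1]
  have hp1 : (fun k => (K k).1) 1 = 1 := by simp [hKR.2.1]
  refine not_isGevrey_taylorCoeff_phi hN ha hb t₀ hs hs' (isGevrey_of_comp hs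
    (p := fun k => (K k).1) (q := fun k => (K k).2) hp0 hp1
    ⟨c₁, c₂, hc₁, hc₂, fun n => (norm_fst_le (K n)).trans (hK n)⟩
    ⟨c₁, c₂, hc₁, hc₂, fun n => (norm_snd_le (K n)).trans (hK n)⟩ fun i => ?_)
  -- Truncating at `i + N` gives divisibility by `X^(i+2)`, which covers the coefficient `i`.
  have h := Polynomial.X_pow_dvd_iff.1
    (X_pow_dvd_of_isFormalSolution hN ha hb t₀ hKR (n := i + N) (by omega)) i (by omega)
  rw [Polynomial.coeff_sub, sub_eq_zero, coeff_truncPoly _ (by omega),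
    coeff_comp_truncPoly hp0 (by omega)] at h
  exact h

end params

end ParabolicGevrey

theorem claim4p3 (N : ℕ) (hN : 2 ≤ N) (a b : ℝ) (ha : 0 < a) (hb : 0 < b) :
    -- the integral converges absolutely, and `φ` is `2π`-periodic in time
    (∀ x t : ℝ, 0 < x → IntegrableOn (integrand N a b x t) (Ioi 0)) ∧
    (∀ x t : ℝ, phi N a b x (t + 2 * Real.pi) = phi N a b x t) ∧
    -- the parabolic stable manifold of the flow is the graph of `φ`
    (∀ t₀ : ℝ, stableSet (field N a b) t₀ = {p | 0 < p.1 ∧ p.2 = phi N a b p.1 t₀}) ∧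
    -- `φ` is smooth up to `x = 0`, so that its Taylor expansion there makes sense
    (∀ t : ℝ, ContDiffOn ℝ (⊤ : ℕ∞) (fun x => phi N a b x t) (Ici 0)) ∧
    -- its Taylor series is `1/(N-1)`-Gevrey, uniformly in time
    (∃ c₁ c₂ : ℝ, 0 < c₁ ∧ 0 < c₂ ∧ ∀ (t : ℝ) (n : ℕ),
      |taylorCoeff (fun x => phi N a b x t) n|
        ≤ c₁ * c₂ ^ n * (n.factorial : ℝ) ^ (1 / ((N : ℝ) - 1))) ∧
    -- and, at every time, it is not Gevrey of any smaller order
    (∀ t γ' : ℝ, 0 ≤ γ' → γ' < 1 / ((N : ℝ) - 1) →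
      ¬ IsGevrey γ' (taylorCoeff (fun x => phi N a b x t))) ∧
    -- sharpness for maps: the Poincaré map has the general form with `M = N` and no `z` variable,
    -- the graph of `φ` is its local stable manifold, and `1/(N-1)` is the optimal Gevrey order
    -- of the formal solutions of its invariance equation
    (∀ t₀ : ℝ,
      (∀ᶠ p in 𝓝 (0 : ℝ × ℝ), SolvableFrom (field N a b) t₀ (2 * Real.pi) p) ∧
      HasParabolicForm N N (2 * Real.pi * a) (2 * Real.pi * b)
        (stroboscopicMap (field N a b) t₀ (2 * Real.pi)) ∧
      (∃ ρ₀ : ℝ, 0 < ρ₀ ∧ ∀ ρ : ℝ, 0 < ρ → ρ ≤ ρ₀ →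
        localStableManifold (stroboscopicMap (field N a b) t₀ (2 * Real.pi)) ρ =
          {p | p ∈ disc ρ ∧ 0 < p.1 ∧ p.2 = phi N a b p.1 t₀}) ∧
      (∃ R : ℕ → ℝ,
        IsFormalSolution (stroboscopicMap (field N a b) t₀ (2 * Real.pi))
          (graphSeries (taylorCoeff (fun x => phi N a b x t₀))) R) ∧
      IsGevrey (1 / ((N : ℝ) - 1)) (graphSeries (taylorCoeff (fun x => phi N a b x t₀))) ∧
      (∀ (K : ℕ → ℝ × ℝ) (R : ℕ → ℝ),
        IsFormalSolution (stroboscopicMap (field N a b) t₀ (2 * Real.pi)) K R →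
        ∀ γ' : ℝ, 0 ≤ γ' → γ' < 1 / ((N : ℝ) - 1) → ¬ IsGevrey γ' K)) := by
  refine ⟨fun x t hx => integrableOn_integrand hN ha hb t hx, phi_add_two_pi,
    stableSet_field hN ha hb, contDiffOn_phi hN ha hb, exists_abs_taylorCoeff_phi_le hN ha hb,
    fun t s hs hs' => not_isGevrey_taylorCoeff_phi hN ha hb t hs hs', fun t₀ => ⟨?_,
    hasParabolicForm_stroboscopicMap hN ha hb t₀ Real.two_pi_pos,
    localStableManifold_stroboscopicMap hN ha hb t₀,
    exists_isFormalSolution_graphSeries hN ha hb t₀, isGevrey_graphSeries hN ha hb t₀,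
    fun K R hKR s hs hs' => not_isGevrey_of_isFormalSolution hN ha hb t₀ hKR hs hs'⟩⟩
  exact (tendsto_fst_zero.eventually (eventually_dil_pos hN a (2 * Real.pi))).mono
    fun _ hp => solvableFrom_of_dil_pos hN ha hb t₀ hp
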